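/- Let $M$ be a connected smooth manifold of dimension $n\ge 3$ with a smooth pseudo-Riemannian metric $g$ of indefinite signature $(s,n-s)$, $0<s<n$ ($s$ minus signs). A 2-dimensional subspace $E\subset T_pM$ is called nondegenerate if $g|_E$ has rank $2$, and weakly isotropic if $g|_E$ has rank $1$. Suppose that $M$ satisfies the axiom of weakly isotropic 2-planes: for every point $p\in M$ and every weakly isotropic 2-plane $E\subset T_pM$ there is a totally geodesic (immersed) submanifold $M'$ of $M$ containing $p$ such that $T_pM'=E$ and all the tangent spaces of $M'$ are weakly isotropic 2-planes. (Here $M'$ is totally geodesic if each geodesic of $M$ whose initial velocity is tangent to $M'$ stays in $M'$ for small times.) Then $M$ has constant sectional curvature: there is a constant $c\in\mathbb{R}$ such that for every $p\in M$ and every nondegenerate 2-plane in $T_pM$ with basis $\{x,y\}$, $$K(x,y)=\frac{R(x,y,y,x)}{g(x,x)g(y,y)-g(x,y)^2}=c ,$$ where $R(x,y,z,w)=g(R(x,y)z,w)$ and $R(X,Y)=[\nabla_X,\nabla_Y]-\nabla_{[X,Y]}$ is the curvature operator of the Levi-Civita connection $\nabla$ of $g$. -/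

import Mathlib

open scoped Manifold ContDiff Bundle
open Module (finrank)

universe u v

noncomputable section

/-- A smooth pseudo-Riemannian metric on a smooth manifold `M` (without boundary) modelled on the
vector space `E`: a smoothly varying family of nondegenerate symmetric bilinear forms on the
tangent spaces. -/
structure PseudoRiemannianMetric (E : Type v) [NormedAddCommGroup E] [NormedSpace ℝ E]
    (M : Type u) [TopologicalSpace M] [ChartedSpace E M] [IsManifold 𝓘(ℝ, E) ∞ M] where
  /-- The bilinear form on the tangent space at `p`. -/
  form (p : M) : TangentSpace 𝓘(ℝ, E) p →L[ℝ] TangentSpace 𝓘(ℝ, E) p →L[ℝ] ℝ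
  symm (p : M) (x y : TangentSpace 𝓘(ℝ, E) p) : form p x y = form p y x
  nondegenerate (p : M) (x : TangentSpace 𝓘(ℝ, E) p) (hx : ∀ y, form p x y = 0) : x = 0
  contMDiff : ContMDiff 𝓘(ℝ, E) (𝓘(ℝ, E).prod 𝓘(ℝ, E →L[ℝ] E →L[ℝ] ℝ)) ∞
    (fun p ↦ Bundle.TotalSpace.mk' (E →L[ℝ] E →L[ℝ] ℝ)
      (E := fun p : M ↦ TangentSpace 𝓘(ℝ, E) p →L[ℝ] TangentSpace 𝓘(ℝ, E) p →L[ℝ] ℝ) p (form p))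

namespace PseudoRiemannianMetric

variable {E : Type v} [NormedAddCommGroup E] [NormedSpace ℝ E]
  {M : Type u} [TopologicalSpace M] [ChartedSpace E M] [IsManifold 𝓘(ℝ, E) ∞ M]
  (g : PseudoRiemannianMetric E M)

/-- `g` has signature `(s, n - s)`: every tangent space has a basis `b` in which `g` reads
`-x₁y₁ - ⋯ - xₛyₛ + xₛ₊₁yₛ₊₁ + ⋯ + xₙyₙ`. -/
def HasSignature (s : ℕ) : Prop :=
  ∀ p : M, ∃ b : Module.Basis (Fin (finrank ℝ E)) ℝ (TangentSpace 𝓘(ℝ, E) p),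
    ∀ i j, g.form p (b i) (b j) = if i = j then (if (i : ℕ) < s then -1 else 1) else 0

/-! ### The Levi-Civita connection and its curvature in a chart -/

/-- The metric read in the chart `e`: the bilinear form `g_{ij}(y)` on `E`, for `y` in the target
of `e`. (The tangent spaces of `M` are, by definition, copies of the model space `E`.) -/
def inChart (e : OpenPartialHomeomorph M E) (y : E) : E →L[ℝ] E →L[ℝ] ℝ :=
  let B : E →L[ℝ] E →L[ℝ] ℝ := g.form (e.symm y)
  let A : E →L[ℝ] E := mfderiv 𝓘(ℝ, E) 𝓘(ℝ, E) e.symm y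
  B.bilinearComp A A

/-- The Christoffel symbol `Γ(a, b)` of the Levi-Civita connection in the chart `e` at `y`, i.e.
the vector `∇_a b` for constant `a`, `b`. It is characterized by
`2 g(Γ(a, b), c) = ∂_a g(b, c) + ∂_b g(a, c) - ∂_c g(a, b)` for all `c`. -/
def christoffel (e : OpenPartialHomeomorph M E) (y a b : E) : E :=
  let D := fderiv ℝ (g.inChart e) y
  (g.inChart e y).inverse ((1 / 2 : ℝ) • (D a b + D b a - (D.flip a).flip b))

/-- The curvature operator `R(a, b) c = ∇_a ∇_b c - ∇_b ∇_a c` (for constant `a`, `b`, `c`, so that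
`[a, b] = 0`) in the chart `e` at `y`. -/
def curvatureInChart (e : OpenPartialHomeomorph M E) (y a b c : E) : E :=
  (fderiv ℝ (fun z ↦ g.christoffel e z b c) y a + g.christoffel e y a (g.christoffel e y b c)) -
    (fderiv ℝ (fun z ↦ g.christoffel e z a c) y b + g.christoffel e y b (g.christoffel e y a c))

/-- The curvature tensor `R(x, y, z, w) = g(R(x, y) z, w)` at the point `p`. It is computed in the
preferred chart at `p`. -/
def curvature (p : M) (x y z w : TangentSpace 𝓘(ℝ, E) p) : ℝ :=
  let e := chartAt E p
  let A : TangentSpace 𝓘(ℝ, E) p →L[ℝ] E := mfderiv 𝓘(ℝ, E) 𝓘(ℝ, E) e p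
  g.inChart e (e p) (g.curvatureInChart e (e p) (A x) (A y) (A z)) (A w)

/-! ### Planes and sectional curvature -/

/-- The rank of the restriction of the metric to a subspace of a tangent space. -/
def rankOn (p : M) (P : Submodule ℝ (TangentSpace 𝓘(ℝ, E) p)) : ℕ :=
  let B : P →ₗ[ℝ] P →ₗ[ℝ] ℝ := (g.form p).toLinearMap₁₂.domRestrict₁₂ P P
  finrank ℝ (LinearMap.range B)

/-- A nondegenerate 2-plane: the restriction of the metric has rank 2. -/
def IsNondegeneratePlane (p : M) (P : Submodule ℝ (TangentSpace 𝓘(ℝ, E) p)) : Prop :=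
  finrank ℝ P = 2 ∧ g.rankOn p P = 2

/-- A weakly isotropic 2-plane: the restriction of the metric has rank 1. -/
def IsWeaklyIsotropicPlane (p : M) (P : Submodule ℝ (TangentSpace 𝓘(ℝ, E) p)) : Prop :=
  finrank ℝ P = 2 ∧ g.rankOn p P = 1

/-- The sectional curvature of the plane spanned by `x` and `y`. -/
def sectionalCurvature (p : M) (x y : TangentSpace 𝓘(ℝ, E) p) : ℝ :=
  g.curvature p x y y x / (g.form p x x * g.form p y y - g.form p x y ^ 2)

/-- All nondegenerate 2-planes, at all points, have the same sectional curvature. -/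
def HasConstantSectionalCurvature : Prop :=
  ∃ c : ℝ, ∀ (p : M) (x y : TangentSpace 𝓘(ℝ, E) p),
    g.IsNondegeneratePlane p (Submodule.span ℝ {x, y}) → g.sectionalCurvature p x y = c

/-! ### Geodesics and totally geodesic submanifolds -/

/-- `γ` restricted to the interval `(-ε, ε)` is a geodesic: it is smooth and satisfies
`γ'' + Γ(γ', γ') = 0` in every chart. -/
def IsGeodesicOn (γ : ℝ → M) (ε : ℝ) : Prop :=
  ContMDiffOn 𝓘(ℝ, ℝ) 𝓘(ℝ, E) ∞ γ (Set.Ioo (-ε) ε) ∧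
    ∀ t ∈ Set.Ioo (-ε) ε, ∀ e ∈ IsManifold.maximalAtlas 𝓘(ℝ, E) ∞ M, γ t ∈ e.source →
      deriv (deriv (e ∘ γ)) t +
        g.christoffel e (e (γ t)) (deriv (e ∘ γ) t) (deriv (e ∘ γ) t) = 0

section Surface

variable {N : Type u} [TopologicalSpace N] [ChartedSpace (EuclideanSpace ℝ (Fin 2)) N]

/-- The tangent space at `q` of the surface `f : N → M`, as a subspace of the tangent space
of `M`. -/
def tangentPlane (f : N → M) (q : N) : Submodule ℝ (TangentSpace 𝓘(ℝ, E) (f q)) :=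
  LinearMap.range (mfderiv (𝓡 2) 𝓘(ℝ, E) f q : TangentSpace (𝓡 2) q →ₗ[ℝ] _)

/-- The surface `f : N → M` is totally geodesic: for every vector `w` tangent to it, the geodesic
of `M` with initial velocity `w` stays in the surface for small times. -/
def IsTotallyGeodesic (f : N → M) : Prop :=
  ∀ (q : N) (w : TangentSpace (𝓡 2) q), ∃ ε > 0, ∃ c : ℝ → N,
    ContMDiffOn 𝓘(ℝ, ℝ) (𝓡 2) ∞ c (Set.Ioo (-ε) ε) ∧
    tangentMap 𝓘(ℝ, ℝ) (𝓡 2) c ⟨0, (1 : ℝ)⟩ = (⟨q, w⟩ : TangentBundle (𝓡 2) N) ∧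
    g.IsGeodesicOn (f ∘ c) ε

end Surface

/-- The axiom of weakly isotropic 2-planes: for each point `p` and each weakly isotropic 2-plane
`P` at `p` there is a totally geodesic submanifold of `M` (an injectively immersed surface
`f : N → M`) through `p` with tangent space `P` at `p`, all of whose tangent spaces are weakly
isotropic. -/
def AxiomOfWeaklyIsotropicPlanes : Prop :=
  ∀ (p : M) (P : Submodule ℝ (TangentSpace 𝓘(ℝ, E) p)), g.IsWeaklyIsotropicPlane p P →
    ∃ (N : Type u) (_ : TopologicalSpace N) (_ : ChartedSpace (EuclideanSpace ℝ (Fin 2)) N)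
      (_ : IsManifold (𝓡 2) ∞ N) (f : N → M),
      Manifold.IsImmersion (𝓡 2) 𝓘(ℝ, E) ∞ f ∧ Function.Injective f ∧
      g.IsTotallyGeodesic f ∧
      (∀ q : N, g.IsWeaklyIsotropicPlane (f q) (tangentPlane f q)) ∧
      ∃ (q : N) (hq : f q = p), hq ▸ tangentPlane (E := E) f q = P

end PseudoRiemannianMetric

end

/-! The curvature is determined by its values on degenerate planes. If x ≠ 0 is null and u is a
non-null vector orthogonal to x, then span{x, u} is weakly isotropic. The surface given by the axiom
has zero second fundamental form, so its tangent plane at the point is invariant under R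
(`IsTotallyGeodesic.curvature_mem`). Hence R(x, u)u lies in span{x, u}, which is orthogonal to x,
and g(R(x, u)u, x) = 0 (`null_curvature_eq_zero`).

The next point is linear algebra. Take null vectors ξ, η with g(ξ, η) = 1 and subtract from R the
multiple of the constant-curvature model that agrees with R on span{ξ, η}. The difference still
satisfies the null condition. Evaluating that condition along the curve of null vectors ξ + tw -
(t²g(w, w)/2)η, with w orthogonal to ξ and η, gives a polynomial in t; its coefficients kill every
component of the difference (`null_expansion`, `frame_components_eq_zero`). So R is a multiple k(p)
of the model at each point (`eq_const_mul_of_null_frame`).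

Finally, Schur's argument applies: in dimension at least 3 the second Bianchi identity forces dk = 0
(`fderiv_eq_zero_of_pointwise_const`). The calculus is done in charts. Transition maps are
isometries of the metrics read in charts, so k does not depend on the chart; it is locally constant,
hence constant on the connected M. -/

/-! ### Algebraic curvature tensors. -/

/-- The symmetries of a curvature tensor on a vector space. -/
structure IsAlgebraicCurvature {V : Type*} [AddCommGroup V] [Module ℝ V]
    (S : V → V → V → V → ℝ) : Prop where
  add_left (x x' y z w : V) : S (x + x') y z w = S x y z w + S x' y z w
  smul_left (t : ℝ) (x y z w : V) : S (t • x) y z w = t * S x y z w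
  antisymm_left (x y z w : V) : S x y z w = -S y x z w
  antisymm_right (x y z w : V) : S x y z w = -S x y w z
  bianchi (x y z w : V) : S x y z w + S y z x w + S z x y w = 0

namespace IsAlgebraicCurvature

variable {V : Type*} [AddCommGroup V] [Module ℝ V] {S : V → V → V → V → ℝ}

theorem pair_symm (h : IsAlgebraicCurvature S) (x y z w : V) : S x y z w = S z w x y := by
  have p : ∀ a b, S y x a b = -S x y a b ∧ S z x a b = -S x z a b ∧ S w x a b = -S x w a b ∧
      S z y a b = -S y z a b ∧ S w y a b = -S y w a b ∧ S w z a b = -S z w a b :=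
    fun a b ↦ ⟨h.antisymm_left .., h.antisymm_left .., h.antisymm_left ..,
      h.antisymm_left .., h.antisymm_left .., h.antisymm_left ..⟩
  have q : ∀ a b, S a b y x = -S a b x y ∧ S a b z x = -S a b x z ∧ S a b w x = -S a b x w ∧
      S a b z y = -S a b y z ∧ S a b w y = -S a b y w ∧ S a b w z = -S a b z w :=
    fun a b ↦ ⟨h.antisymm_right .., h.antisymm_right .., h.antisymm_right ..,
      h.antisymm_right .., h.antisymm_right .., h.antisymm_right ..⟩
  -- The classical octahedron argument: add the four Bianchi identities obtained by rotating x, y,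
  -- z, w, after the skew symmetries have brought all terms to a common ordering.
  have b1 := h.bianchi x y z w
  have b2 := h.bianchi y z w x
  have b3 := h.bianchi z w x y
  have b4 := h.bianchi w x y z
  simp only [p, q] at b1 b2 b3 b4
  linarith

theorem add₂ (h : IsAlgebraicCurvature S) (x y y' z w : V) :
    S x (y + y') z w = S x y z w + S x y' z w := by
  rw [h.antisymm_left, h.add_left, h.antisymm_left x y, h.antisymm_left x y']; ring

theorem add₃ (h : IsAlgebraicCurvature S) (x y z z' w : V) :
    S x y (z + z') w = S x y z w + S x y z' w := by
  rw [h.pair_symm, h.add_left, h.pair_symm x y, h.pair_symm x y]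

theorem add₄ (h : IsAlgebraicCurvature S) (x y z w w' : V) :
    S x y z (w + w') = S x y z w + S x y z w' := by
  rw [h.pair_symm, h.add₂, h.pair_symm x y, h.pair_symm x y]

theorem smul₂ (h : IsAlgebraicCurvature S) (t : ℝ) (x y z w : V) :
    S x (t • y) z w = t * S x y z w := by
  rw [h.antisymm_left, h.smul_left, h.antisymm_left x y]; ring

theorem smul₃ (h : IsAlgebraicCurvature S) (t : ℝ) (x y z w : V) :
    S x y (t • z) w = t * S x y z w := by
  rw [h.pair_symm, h.smul_left, h.pair_symm x y]

theorem smul₄ (h : IsAlgebraicCurvature S) (t : ℝ) (x y z w : V) :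
    S x y z (t • w) = t * S x y z w := by
  rw [h.pair_symm, h.smul₂, h.pair_symm x y]

theorem self_left (h : IsAlgebraicCurvature S) (x z w : V) : S x x z w = 0 := by
  linarith [h.antisymm_left x x z w]

theorem self_right (h : IsAlgebraicCurvature S) (x y z : V) : S x y z z = 0 := by
  linarith [h.antisymm_right x y z z]

/-- An algebraic curvature tensor is determined by its sectional curvatures. -/
theorem eq_zero (h : IsAlgebraicCurvature S) (h0 : ∀ x y, S x y y x = 0) (x y z w : V) :
    S x y z w = 0 := by
  -- Polarize in the outer pair, then in the inner pair. The tensor becomes totally skew in its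
  -- first three arguments, so the Bianchi sum equals 3 S x y z w.
  have h1 : ∀ x y w, S x y y w = 0 := fun x y w ↦ by
    have := h0 (x + w) y
    simp only [h.add_left, h.add₄, h0] at this
    have h2 : S w y y x = S x y y w := by
      rw [h.pair_symm, h.antisymm_left, h.antisymm_right]; ring
    linarith
  have h2 : ∀ x y z w, S x y z w = -S x z y w := fun x y z w ↦ by
    have := h1 x (y + z) w
    simp only [h.add₂, h.add₃, h1] at this
    linarith
  linarith [h.bianchi x y z w, h2 x y z w, h2 y z x w, h.antisymm_left x z y w, h2 z x y w,
    h.antisymm_left y x z w, h.antisymm_left z y x w]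

/-- Permits subtracting the constant-curvature model without leaving the class of curvature tensors.
-/
theorem sub_const_mul {g : V →ₗ[ℝ] V →ₗ[ℝ] ℝ} (hg : ∀ x y, g x y = g y x)
    (h : IsAlgebraicCurvature S) (k : ℝ) :
    IsAlgebraicCurvature fun x y z w ↦ S x y z w - k * (g y z * g x w - g x z * g y w) where
  add_left x x' y z w := by simp only [h.add_left, map_add, LinearMap.add_apply]; ring
  smul_left t x y z w := by
    simp only [h.smul_left, map_smul, LinearMap.smul_apply, smul_eq_mul]; ring
  antisymm_left x y z w := by linear_combination h.antisymm_left x y z w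
  antisymm_right x y z w := by linear_combination h.antisymm_right x y z w
  bianchi x y z w := by rw [hg y z, hg z x, hg x y]; linear_combination h.bianchi x y z w

end IsAlgebraicCurvature

/-! ### Null frames, and tensors whose null sectional curvatures vanish. -/

section NullFrame

variable {V : Type*} [AddCommGroup V] [Module ℝ V] {g : V →ₗ[ℝ] V →ₗ[ℝ] ℝ}

/-- `ξ`, `η` is a pair of null vectors with `g(ξ, η) = 1` and `v` is a non-null vector orthogonal
to both. -/
structure IsNullFrame (g : V →ₗ[ℝ] V →ₗ[ℝ] ℝ) (ξ η v : V) : Prop where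
  left : g ξ ξ = 0
  right : g η η = 0
  pair : g ξ η = 1
  orth_left : g ξ v = 0
  orth_right : g η v = 0
  nonnull : g v v ≠ 0

theorem IsNullFrame.of_orthonormal {e f v : V} (he : g e e = -1) (hf : g f f = 1) (hef : g e f = 0)
    (hfe : g f e = 0) (hev : g e v = 0) (hfv : g f v = 0) (hv : g v v ≠ 0) :
    IsNullFrame g (e + f) ((1 / 2 : ℝ) • (f - e)) v := by
  constructor <;> simp [he, hf, hef, hfe, hev, hfv, hv]
  norm_num

/-- Non-null vectors are dense in every line through a non-null direction. -/
theorem eq_zero_of_eq_zero_of_nonnull (hg : ∀ x y, g x y = g y x) {v₀ : V} (h₀ : g v₀ v₀ ≠ 0)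
    (v : V) (f : V → ℝ) (hf : Continuous fun t : ℝ ↦ f (v + t • v₀))
    (h : ∀ t : ℝ, g (v + t • v₀) (v + t • v₀) ≠ 0 → f (v + t • v₀) = 0) : f v = 0 := by
  by_cases hv : g v v = 0
  swap
  · simpa using h 0 (by simpa using hv)
  -- For null v the square of v + t v₀ is t times an affine function of t that is not identically
  -- zero, so it is nonzero for all small t ≠ 0.
  have hexp : ∀ t : ℝ, g (v + t • v₀) (v + t • v₀) = t * (2 * g v v₀ + t * g v₀ v₀) := fun t ↦ by
    simp only [map_add, map_smul, LinearMap.add_apply, LinearMap.smul_apply, smul_eq_mul, hv,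
      hg v₀ v]
    ring
  have hev : ∀ᶠ t : ℝ in nhdsWithin 0 {0}ᶜ, 2 * g v v₀ + t * g v₀ v₀ ≠ 0 := by
    by_cases hb : g v v₀ = 0
    · filter_upwards [self_mem_nhdsWithin] with t ht
      simpa [hb] using ⟨ht, h₀⟩
    · have : ContinuousAt (fun t : ℝ ↦ 2 * g v v₀ + t * g v₀ v₀) 0 := by fun_prop
      exact (this.eventually_ne (by simpa using hb)).filter_mono nhdsWithin_le_nhds
  have hz : ∀ᶠ t : ℝ in nhdsWithin 0 {0}ᶜ, f (v + t • v₀) = 0 := by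
    filter_upwards [hev, self_mem_nhdsWithin] with t ht ht0
    exact h t (by rw [hexp]; exact mul_ne_zero ht0 ht)
  have h1 : Filter.Tendsto (fun t : ℝ ↦ f (v + t • v₀)) (nhdsWithin 0 {0}ᶜ)
      (nhds (f (v + (0 : ℝ) • v₀))) := (hf.tendsto 0).mono_left nhdsWithin_le_nhds
  have h2 := tendsto_nhds_unique (h1.congr' hz) tendsto_const_nhds
  simpa using h2

namespace IsAlgebraicCurvature

variable {S : V → V → V → V → ℝ} {ξ η v₀ : V}

/-- The vector x(t) = ξ + tw - (t²g(w, w)/2)η is null and u(t) = v - t g(w, v)η is orthogonal to it,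
with g(u(t), u(t)) = g(v, v). The quartic S(x(t), u(t), u(t), x(t)) therefore vanishes identically;
the conclusions are its coefficients of degrees 0, 1 and 2. -/
theorem null_expansion (hg : ∀ x y, g x y = g y x) (hS : IsAlgebraicCurvature S)
    (h : ∀ x u, x ≠ 0 → g x x = 0 → g x u = 0 → g u u ≠ 0 → S x u u x = 0)
    (hF : IsNullFrame g ξ η v₀) (h0 : S ξ η η ξ = 0) {v w : V} (hvξ : g ξ v = 0) (hvη : g η v = 0)
    (hwξ : g ξ w = 0) (hwη : g η w = 0) :
    S ξ v v ξ = 0 ∧ S ξ v v w = g w v * S ξ v η ξ ∧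
      2 * g w v * S ξ v w η - g w w * S ξ v v η + S w v v w - 2 * g w v * S w v η ξ = 0 := by
  -- The null condition requires v non-null; density along the direction v₀ removes this
  -- restriction.
  have hgen : ∀ t : ℝ, S (ξ + t • w - (t ^ 2 * g w w / 2) • η) (v - (t * g w v) • η)
      (v - (t * g w v) • η) (ξ + t • w - (t ^ 2 * g w w / 2) • η) = 0 := fun t ↦ by
    refine eq_zero_of_eq_zero_of_nonnull hg hF.nonnull v
      (fun v ↦ S (ξ + t • w - (t ^ 2 * g w w / 2) • η) (v - (t * g w v) • η)
        (v - (t * g w v) • η) (ξ + t • w - (t ^ 2 * g w w / 2) • η)) ?_ ?_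
    · simp only [sub_eq_add_neg, ← neg_smul, hS.add_left, hS.add₂, hS.add₃, hS.add₄, hS.smul_left,
        hS.smul₂, hS.smul₃, hS.smul₄, map_add, map_smul, smul_eq_mul]
      fun_prop
    · intro r hr
      set v' := v + r • v₀ with hv'
      have h1 : g ξ v' = 0 := by simp [hv', hvξ, hF.orth_left]
      have h2 : g η v' = 0 := by simp [hv', hvη, hF.orth_right]
      have e := hF.pair
      have e' := hF.pair
      rw [hg] at e'
      have w1 := hwξ
      rw [hg] at w1
      have w2 := hwη
      rw [hg] at w2
      have h2' := h2
      rw [hg] at h2'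
      apply h
      · intro hx
        have := congrArg (fun z ↦ g z η) hx
        simp [e, w2, hF.right] at this
      · simp [e, e', w1, w2, hwξ, hwη, hF.left, hF.right]
        ring
      · simp [e, w2, hF.right, h1, h2]
      · simpa [h2, h2', hF.right] using hr
  have p : ∀ a b, S η ξ a b = -S ξ η a b ∧ S w ξ a b = -S ξ w a b ∧ S v ξ a b = -S ξ v a b ∧
      S w η a b = -S η w a b ∧ S v η a b = -S η v a b ∧ S v w a b = -S w v a b :=
    fun a b ↦ ⟨hS.antisymm_left .., hS.antisymm_left .., hS.antisymm_left ..,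
      hS.antisymm_left .., hS.antisymm_left .., hS.antisymm_left ..⟩
  have q : ∀ a b, S a b η ξ = -S a b ξ η ∧ S a b w ξ = -S a b ξ w ∧ S a b v ξ = -S a b ξ v ∧
      S a b w η = -S a b η w ∧ S a b v η = -S a b η v ∧ S a b v w = -S a b w v :=
    fun a b ↦ ⟨hS.antisymm_right .., hS.antisymm_right .., hS.antisymm_right ..,
      hS.antisymm_right .., hS.antisymm_right .., hS.antisymm_right ..⟩
  have s1 := hS.pair_symm η w ξ v
  have s2 := hS.pair_symm η v ξ v
  have s3 := hS.pair_symm w v ξ η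
  have s4 := hS.pair_symm w v ξ v
  have s5 := hS.pair_symm ξ v ξ η
  have key : ∀ t : ℝ, S ξ v v ξ + t * (2 * (S ξ v v w - g w v * S ξ v η ξ)) +
      t ^ 2 * (2 * g w v * S ξ v w η - g w w * S ξ v v η + S w v v w - 2 * g w v * S w v η ξ) +
      t ^ 3 * (2 * g w v * S w v w η - g w w * S w v v η
        - 2 * g w v ^ 2 * S ξ η w η + g w v * g w w * S ξ η v η) +
      t ^ 4 * (g w v ^ 2 * S η w w η - g w v * g w w * S η w v η + g w w ^ 2 / 4 * S η v v η) = 0 := by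
    intro t
    have := hgen t
    simp only [sub_eq_add_neg, ← neg_smul, hS.add_left, hS.add₂, hS.add₃, hS.add₄, hS.smul_left,
        hS.smul₂, hS.smul₃, hS.smul₄] at this
    rw [← this]
    have s6 := hS.pair_symm w v η w
    have s7 := hS.pair_symm w v η v
    have s8 := hS.pair_symm ξ η η w
    have s9 := hS.pair_symm ξ η η v
    have s10 := hS.pair_symm η w η v
    simp only [p, q, s1, s2, s3, s4, s5, s6, s7, s8, s9, s10, hS.self_left, hS.self_right] at h0 ⊢
    linear_combination (-t ^ 2 * g w v ^ 2) * h0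
  -- A quartic with five zeros has only zero coefficients.
  refine ⟨?_, ?_, ?_⟩ <;> linarith [key 0, key 1, key (-1), key 2, key (-2)]

/-- The coefficients from `null_expansion` are separated by setting w = v, by exchanging v and w,
and by the Bianchi identity. Factors such as g(v, v) are cancelled for non-null v, and the result
extends to all v by density. -/
theorem frame_components_eq_zero (hg : ∀ x y, g x y = g y x) (hS : IsAlgebraicCurvature S)
    (h : ∀ x u, x ≠ 0 → g x x = 0 → g x u = 0 → g u u ≠ 0 → S x u u x = 0)
    (hF : IsNullFrame g ξ η v₀) (h0 : S ξ η η ξ = 0) {v w : V} (hvξ : g ξ v = 0) (hvη : g η v = 0)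
    (hwξ : g ξ w = 0) (hwη : g η w = 0) :
    S ξ v w ξ = 0 ∧ S ξ v w η = 0 ∧ S w v η ξ = 0 ∧ S w v v w = 0 ∧ S ξ v η ξ = 0 ∧
      S ξ v v w = 0 := by
  have line : ∀ {v w : V}, (g ξ v = 0 ∧ g η v = 0) → (g ξ w = 0 ∧ g η w = 0) → ∀ t : ℝ,
      g ξ (v + t • w) = 0 ∧ g η (v + t • w) = 0 := by
    intro v w hv hw t
    simp [hv, hw]
  have exp : ∀ {v w : V}, (g ξ v = 0 ∧ g η v = 0) → (g ξ w = 0 ∧ g η w = 0) →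
      S ξ v v ξ = 0 ∧ S ξ v v w = g w v * S ξ v η ξ ∧
      2 * g w v * S ξ v w η - g w w * S ξ v v η + S w v v w - 2 * g w v * S w v η ξ = 0 :=
    fun hv hw ↦ hS.null_expansion hg h hF h0 hv.1 hv.2 hw.1 hw.2
  have hv₀ := And.intro hF.orth_left hF.orth_right
  have e1 : ∀ {v : V}, (g ξ v = 0 ∧ g η v = 0) → S ξ v v η = 0 := by
    intro v hv
    refine eq_zero_of_eq_zero_of_nonnull hg hF.nonnull v (fun v ↦ S ξ v v η) ?_ ?_
    · simp only [hS.add₂, hS.add₃, hS.smul₂, hS.smul₃]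
      fun_prop
    · intro t ht
      have := (exp (line hv hv₀ t) (line hv hv₀ t)).2.2
      simp only [hS.self_left] at this
      have h3 : g (v + t • v₀) (v + t • v₀) * S ξ (v + t • v₀) (v + t • v₀) η = 0 := by linarith
      exact (mul_eq_zero.1 h3).resolve_left ht
  have e2 : ∀ {v w : V}, (g ξ v = 0 ∧ g η v = 0) → (g ξ w = 0 ∧ g η w = 0) →
      S ξ v w η = -S ξ w v η := by
    intro v w hv hw
    have := e1 (line hv hw 1)
    simp only [one_smul, hS.add₂, hS.add₃, e1 hv, e1 hw] at this
    linarith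
  have e3 : ∀ {v w : V}, (g ξ v = 0 ∧ g η v = 0) → (g ξ w = 0 ∧ g η w = 0) →
      S w v η ξ = -2 * S ξ v w η := by
    intro v w hv hw
    have h1 := hS.bianchi w v η ξ
    rw [hS.pair_symm v η, hS.antisymm_left w ξ, hS.pair_symm η w, hS.antisymm_left v ξ,
      hS.antisymm_right ξ v η] at h1
    linarith [e2 hv hw]
  -- The quadratic coefficient now reads 6 g(w, v) S(ξ, v, w, η) + S(w, v, v, w) = 0. Exchanging v
  -- and w changes the sign of the first term only, so both terms vanish.
  have e4 : ∀ {v w : V}, (g ξ v = 0 ∧ g η v = 0) → (g ξ w = 0 ∧ g η w = 0) →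
      S w v v w = 0 ∧ g w v * S ξ v w η = 0 := by
    intro v w hv hw
    have h1 := (exp hv hw).2.2
    have h2 := (exp hw hv).2.2
    rw [e3 hv hw, e1 hv] at h1
    rw [e3 hw hv, e1 hw, e2 hw hv, hg v w, hS.antisymm_left v w, hS.antisymm_right w v] at h2
    constructor <;> linarith
  have e5 : ∀ {v w : V}, (g ξ v = 0 ∧ g η v = 0) → (g ξ w = 0 ∧ g η w = 0) → S ξ v w η = 0 := by
    intro v w hv hw
    refine eq_zero_of_eq_zero_of_nonnull hg hF.nonnull v (fun v ↦ S ξ v w η) ?_ ?_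
    · simp only [hS.add₂, hS.smul₂]
      fun_prop
    · intro t ht
      set v' := v + t • v₀
      have hv' : g ξ v' = 0 ∧ g η v' = 0 := line hv hv₀ t
      -- If g(w, v') = 0, replace w by w + v': the pairing with v' becomes g(v', v') ≠ 0, while S(ξ,
      -- v', ·, η) keeps its value by `e1`.
      rcases mul_eq_zero.1 (e4 hv' hw).2 with h1 | h1
      · have h2 := (e4 hv' (line hw hv' 1)).2
        simpa [hS.add₃, e1 hv', h1, ht] using h2
      · exact h1
  have e6 : ∀ {v : V}, (g ξ v = 0 ∧ g η v = 0) → S ξ v η ξ = 0 := by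
    intro v hv
    refine eq_zero_of_eq_zero_of_nonnull hg hF.nonnull v (fun v ↦ S ξ v η ξ) ?_ ?_
    · simp only [hS.add₂, hS.smul₂]
      fun_prop
    · intro t ht
      have := (exp (line hv hv₀ t) (line hv hv₀ t)).2.1
      simp only [hS.self_right] at this
      exact (mul_eq_zero.1 this.symm).resolve_left ht
  have hv := And.intro hvξ hvη
  have hw := And.intro hwξ hwη
  refine ⟨?_, e5 hv hw, by rw [e3 hv hw, e5 hv hw, mul_zero], (e4 hv hw).1, e6 hv,
    by rw [(exp hv hw).2.1, e6 hv, mul_zero]⟩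
  have h1 := (exp (line hv hw 1) hw).1
  have h2 := hS.pair_symm ξ w v ξ
  rw [hS.antisymm_left v ξ, hS.antisymm_right ξ v ξ w, neg_neg] at h2
  simp only [one_smul, hS.add₂, hS.add₃, (exp hv hw).1, (exp hw hv).1] at h1
  linarith

/-- The hypotheses are symmetric in ξ and η, so the component identities hold for both orders.
Splitting x and y along ξ, η and their orthogonal complement leaves no other components in S x y y
x. -/
theorem eq_zero_of_null_frame (hg : ∀ x y, g x y = g y x) (hS : IsAlgebraicCurvature S)
    (h : ∀ x u, x ≠ 0 → g x x = 0 → g x u = 0 → g u u ≠ 0 → S x u u x = 0)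
    (hF : IsNullFrame g ξ η v₀) (h0 : S ξ η η ξ = 0) (x y z w : V) : S x y z w = 0 := by
  refine hS.eq_zero (fun x y ↦ ?_) x y z w
  have hF' : IsNullFrame g η ξ v₀ :=
    ⟨hF.right, hF.left, hg ξ η ▸ hF.pair, hF.orth_right, hF.orth_left, hF.nonnull⟩
  have h0' : S η ξ ξ η = 0 := by
    rw [hS.antisymm_left, hS.antisymm_right, h0]; simp
  have dec : ∀ x, ∃ (a b : ℝ) (w : V), g ξ w = 0 ∧ g η w = 0 ∧ x = a • ξ + b • η + w := by
    intro x
    refine ⟨g η x, g ξ x, x - g η x • ξ - g ξ x • η, ?_, ?_, by abel⟩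
    · simp [hF.left, hF.pair]
    · simp [hF.right, hF'.pair]
  obtain ⟨a, b, w, hwξ, hwη, rfl⟩ := dec x
  obtain ⟨a', b', v, hvξ, hvη, rfl⟩ := dec y
  have A := hS.frame_components_eq_zero hg h hF h0 hvξ hvη hwξ hwη
  have A1 := hS.frame_components_eq_zero hg h hF h0 hwξ hwη hvξ hvη
  have A2 := hS.frame_components_eq_zero hg h hF h0 hwξ hwη hwξ hwη
  have A3 := hS.frame_components_eq_zero hg h hF h0 hvξ hvη hvξ hvη
  have B := hS.frame_components_eq_zero hg h hF' h0' hvη hvξ hwη hwξ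
  have B1 := hS.frame_components_eq_zero hg h hF' h0' hwη hwξ hvη hvξ
  have B2 := hS.frame_components_eq_zero hg h hF' h0' hwη hwξ hwη hwξ
  have B3 := hS.frame_components_eq_zero hg h hF' h0' hvη hvξ hvη hvξ
  have p : ∀ a b, S η ξ a b = -S ξ η a b ∧ S w ξ a b = -S ξ w a b ∧ S v ξ a b = -S ξ v a b ∧
      S w η a b = -S η w a b ∧ S v η a b = -S η v a b ∧ S v w a b = -S w v a b :=
    fun a b ↦ ⟨hS.antisymm_left .., hS.antisymm_left .., hS.antisymm_left ..,
      hS.antisymm_left .., hS.antisymm_left .., hS.antisymm_left ..⟩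
  have q : ∀ a b, S a b η ξ = -S a b ξ η ∧ S a b w ξ = -S a b ξ w ∧ S a b v ξ = -S a b ξ v ∧
      S a b w η = -S a b η w ∧ S a b v η = -S a b η v ∧ S a b v w = -S a b w v :=
    fun a b ↦ ⟨hS.antisymm_right .., hS.antisymm_right .., hS.antisymm_right ..,
      hS.antisymm_right .., hS.antisymm_right .., hS.antisymm_right ..⟩
  simp only [p, q, neg_eq_zero] at h0 A A1 A2 A3 B B1 B2 B3
  have r1 := hS.pair_symm ξ η ξ v
  have r2 := hS.pair_symm ξ η ξ w
  have r3 := hS.pair_symm ξ η η v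
  have r4 := hS.pair_symm ξ η η w
  have r5 := hS.pair_symm w v ξ v
  have r6 := hS.pair_symm w v ξ w
  have r7 := hS.pair_symm w v η v
  have r8 := hS.pair_symm w v η w
  have r9 := hS.pair_symm ξ η w v
  have r10 := hS.pair_symm η v ξ w
  have r11 := hS.pair_symm η w ξ v
  have r12 := hS.pair_symm η w ξ w
  have r13 := hS.pair_symm η v ξ v
  simp only [hS.add_left, hS.add₂, hS.add₃, hS.add₄, hS.smul_left, hS.smul₂, hS.smul₃, hS.smul₄,
    p, q, hS.self_left, hS.self_right, r1, r2, r3, r4, r5, r6, r7, r8, r9, r10, r11, r12, r13,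
    h0, A, A1, A2, A3, B, B1, B2, B3, mul_zero, add_zero, neg_zero]

/-- A curvature tensor whose null sectional curvatures vanish has constant sectional curvature. -/
theorem eq_const_mul_of_null_frame (hg : ∀ x y, g x y = g y x) (hS : IsAlgebraicCurvature S)
    (h : ∀ x u, x ≠ 0 → g x x = 0 → g x u = 0 → g u u ≠ 0 → S x u u x = 0)
    (hF : IsNullFrame g ξ η v₀) :
    ∃ k : ℝ, ∀ x y z w, S x y z w = k * (g y z * g x w - g x z * g y w) := by
  -- The model takes the value g(η, η)g(ξ, ξ) - g(ξ, η)² = -1 on the frame, which fixes the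
  -- constant.
  refine ⟨-S ξ η η ξ, fun x y z w ↦ ?_⟩
  have := (hS.sub_const_mul hg (-S ξ η η ξ)).eq_zero_of_null_frame hg ?_ hF ?_ x y z w
  · linarith
  · intro x u hx hxx hxu huu
    simp only [h x u hx hxx hxu huu, hxx, hg u x, hxu]
    ring
  · simp only [hF.left, hF.right, hF.pair, hg η ξ]
    ring

end IsAlgebraicCurvature

end NullFrame

noncomputable section

set_option maxSynthPendingDepth 3
set_option synthInstance.maxHeartbeats 100000

/-! ### Connections on a vector space: naturality of curvature and the second Bianchi identity. -/

section Connection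

variable {E : Type*} [NormedAddCommGroup E] [NormedSpace ℝ E]
  {V : Type*} [NormedAddCommGroup V] [NormedSpace ℝ V]

theorem ContDiffAt.fderiv_infty {f : V → E} {x : V} (h : ContDiffAt ℝ ∞ f x) :
    ContDiffAt ℝ ∞ (fderiv ℝ f) x :=
  h.fderiv_right (by simp)

theorem ContDiffAt.fderiv_fderiv_comm {f : V → E} {x : V} (h : ContDiffAt ℝ ∞ f x) (a b : V) :
    fderiv ℝ (fderiv ℝ f) x a b = fderiv ℝ (fderiv ℝ f) x b a :=
  (h.isSymmSndFDerivAt (by simpa using ENat.LEInfty.out)).eq a b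

/-- The curvature of the connection with Christoffel symbols `Γ` on a vector space. -/
def connectionCurvature (Γ : E → E →L[ℝ] E →L[ℝ] E) (y a b c : E) : E :=
  (fderiv ℝ Γ y a b c + Γ y a (Γ y b c)) - (fderiv ℝ Γ y b a c + Γ y b (Γ y a c))

/-- If the connection `C` is related to `Γ` through `F`, so are the curvatures. -/
theorem fderiv_connectionCurvature {F : V → E} {o : V} {C : V → V →L[ℝ] V →L[ℝ] V}
    {Γ : E → E →L[ℝ] E →L[ℝ] E} (hF : ContDiffAt ℝ ∞ F o) (hC : DifferentiableAt ℝ C o)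
    (hΓ : DifferentiableAt ℝ Γ (F o))
    (h : ∀ᶠ u in nhds o, ∀ b c, fderiv ℝ F u (C u b c) =
      Γ (F u) (fderiv ℝ F u b) (fderiv ℝ F u c) + fderiv ℝ (fderiv ℝ F) u b c) (a b c : V) :
    fderiv ℝ F o (connectionCurvature C o a b c) =
      connectionCurvature Γ (F o) (fderiv ℝ F o a) (fderiv ℝ F o b) (fderiv ℝ F o c) := by
  have hF1 : ContDiffAt ℝ ∞ (fderiv ℝ F) o := hF.fderiv_infty
  have hF2 : ContDiffAt ℝ ∞ (fderiv ℝ (fderiv ℝ F)) o := hF1.fderiv_infty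
  have d0 : HasFDerivAt F (fderiv ℝ F o) o := (hF.differentiableAt (by simp)).hasFDerivAt
  have d1 := (hF1.differentiableAt (by simp)).hasFDerivAt
  have d2 := (hF2.differentiableAt (by simp)).hasFDerivAt
  have dΓ := hΓ.hasFDerivAt.comp o d0
  have symm2 : ∀ a b, fderiv ℝ (fderiv ℝ F) o a b = fderiv ℝ (fderiv ℝ F) o b a :=
    fun a b ↦ hF.fderiv_fderiv_comm a b
  have symm3 : ∀ a b, fderiv ℝ (fderiv ℝ (fderiv ℝ F)) o a b =
      fderiv ℝ (fderiv ℝ (fderiv ℝ F)) o b a :=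
    fun a b ↦ hF1.fderiv_fderiv_comm a b
  -- The derivative of `h` in the direction a. After skew-symmetrizing in a and b, the third
  -- derivatives of F cancel.
  have key : ∀ a b c, fderiv ℝ F o (fderiv ℝ C o a b c) +
        fderiv ℝ (fderiv ℝ F) o a (C o b c) =
      (fderiv ℝ Γ (F o) (fderiv ℝ F o a) (fderiv ℝ F o b) (fderiv ℝ F o c) +
        Γ (F o) (fderiv ℝ (fderiv ℝ F) o a b) (fderiv ℝ F o c) +
        Γ (F o) (fderiv ℝ F o b) (fderiv ℝ (fderiv ℝ F) o a c)) +
      fderiv ℝ (fderiv ℝ (fderiv ℝ F)) o a b c := by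
    intro a b c
    have hC1 := (hC.hasFDerivAt.clm_apply (hasFDerivAt_const b o)).clm_apply (hasFDerivAt_const c o)
    have hl := d1.clm_apply hC1
    have hr := ((dΓ.clm_apply (d1.clm_apply (hasFDerivAt_const b o))).clm_apply
      (d1.clm_apply (hasFDerivAt_const c o))).add
        ((d2.clm_apply (hasFDerivAt_const b o)).clm_apply (hasFDerivAt_const c o))
    have hlr := hl.unique (hr.congr_of_eventuallyEq (h.mono fun u hu ↦ hu b c))
    have := DFunLike.congr_fun hlr a
    simp at this
    rw [this]
    abel
  have h0 := h.self_of_nhds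
  have k1 := key a b c
  have k2 := key b a c
  have e1 := h0 a (C o b c)
  have e2 := h0 b (C o a c)
  rw [h0 b c, map_add] at e1
  rw [h0 a c, map_add] at e2
  rw [symm3 b a, symm2 b a] at k2
  simp only [connectionCurvature, map_add, map_sub, e1, e2]
  rw [eq_sub_of_add_eq k1, eq_sub_of_add_eq k2]
  abel

/-- The second Bianchi identity. -/
theorem connectionCurvature_bianchi {Γ : E → E →L[ℝ] E →L[ℝ] E} {y : E}
    (hΓ : ContDiffAt ℝ ∞ Γ y) (a b c z : E) :
    (fderiv ℝ (fun u ↦ connectionCurvature Γ u a b z) y c +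
        Γ y c (connectionCurvature Γ y a b z) - connectionCurvature Γ y a b (Γ y c z)) +
      (fderiv ℝ (fun u ↦ connectionCurvature Γ u b c z) y a +
        Γ y a (connectionCurvature Γ y b c z) - connectionCurvature Γ y b c (Γ y a z)) +
      (fderiv ℝ (fun u ↦ connectionCurvature Γ u c a z) y b +
        Γ y b (connectionCurvature Γ y c a z) - connectionCurvature Γ y c a (Γ y b z)) = 0 := by
  have hΓ1 : ContDiffAt ℝ ∞ (fderiv ℝ Γ) y := hΓ.fderiv_infty
  have d0 := (hΓ.differentiableAt (by simp)).hasFDerivAt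
  have d1 := (hΓ1.differentiableAt (by simp)).hasFDerivAt
  have symm2 : ∀ a b, fderiv ℝ (fderiv ℝ Γ) y a b = fderiv ℝ (fderiv ℝ Γ) y b a :=
    fun a b ↦ hΓ.fderiv_fderiv_comm a b
  -- The cyclic sum omits terms such as R(Γ(c, a), b)z, which cancel for a torsion-free connection.
  -- In this form the identity uses only the symmetry of the second derivative of Γ, not that of Γ
  -- itself.
  have key : ∀ a b z c, fderiv ℝ (fun u ↦ connectionCurvature Γ u a b z) y c =
      (fderiv ℝ (fderiv ℝ Γ) y c a b z + (fderiv ℝ Γ y c a (Γ y b z) +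
        Γ y a (fderiv ℝ Γ y c b z))) -
      (fderiv ℝ (fderiv ℝ Γ) y c b a z + (fderiv ℝ Γ y c b (Γ y a z) +
        Γ y b (fderiv ℝ Γ y c a z))) := by
    intro a b z c
    have k : ∀ x, HasFDerivAt (fun _ : E ↦ x) (0 : E →L[ℝ] E) y := fun x ↦ hasFDerivAt_const x y
    have t1 : ∀ a b, _ := fun a b ↦ ((d1.clm_apply (k a)).clm_apply (k b)).clm_apply (k z)
    have t2 : ∀ a b, _ := fun a b ↦
      (d0.clm_apply (k a)).clm_apply ((d0.clm_apply (k b)).clm_apply (k z))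
    have := (((t1 a b).add (t2 a b)).sub ((t1 b a).add (t2 b a))).fderiv
    have := DFunLike.congr_fun this c
    refine Eq.trans this ?_
    simp
    abel
  rw [key, key, key]
  simp only [connectionCurvature, map_add, map_sub]
  rw [symm2 c a, symm2 c b, symm2 b a]
  abel

theorem ContDiffAt.connectionCurvature {Γ : E → E →L[ℝ] E →L[ℝ] E} {y : E}
    (hΓ : ContDiffAt ℝ ∞ Γ y) (a b z : E) :
    ContDiffAt ℝ ∞ (fun u ↦ connectionCurvature Γ u a b z) y := by
  have hΓ1 : ContDiffAt ℝ ∞ (fderiv ℝ Γ) y := hΓ.fderiv_infty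
  have t1 : ∀ a b, ContDiffAt ℝ ∞ (fun u ↦ fderiv ℝ Γ u a b z) y := fun a b ↦
    ((hΓ1.clm_apply (contDiffAt_const (c := a))).clm_apply (contDiffAt_const (c := b))).clm_apply
      (contDiffAt_const (c := z))
  have t2 : ∀ a b, ContDiffAt ℝ ∞ (fun u ↦ Γ u a (Γ u b z)) y := fun a b ↦
    (hΓ.clm_apply (contDiffAt_const (c := a))).clm_apply
      ((hΓ.clm_apply (contDiffAt_const (c := b))).clm_apply (contDiffAt_const (c := z)))
  exact ((t1 a b).add (t2 a b)).sub ((t1 b a).add (t2 b a))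

end Connection

/-! ### The Levi-Civita connection of a metric on an open set, and Schur's theorem. -/

section LeviCivita

variable {E : Type*} [NormedAddCommGroup E] [NormedSpace ℝ E]

/-- The Christoffel symbols of the Levi-Civita connection of the metric `G` on a vector space. -/
def leviCivita (G : E → E →L[ℝ] E →L[ℝ] ℝ) (y : E) : E →L[ℝ] E →L[ℝ] E :=
  -- Koszul's formula bundled as a continuous bilinear map, so that Γ can be differentiated as a
  -- function of y. The twice-flipped term is c ↦ ∂_c G(a, b).
  (ContinuousLinearMap.compL ℝ E (E →L[ℝ] ℝ) E (G y).inverse).comp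
    ((1 / 2 : ℝ) • (fderiv ℝ G y + (fderiv ℝ G y).flip -
      ((ContinuousLinearMap.flipₗᵢ ℝ E E ℝ).toContinuousLinearEquiv :
        (E →L[ℝ] E →L[ℝ] ℝ) →L[ℝ] (E →L[ℝ] E →L[ℝ] ℝ)).comp (fderiv ℝ G y).flip))

theorem leviCivita_apply (G : E → E →L[ℝ] E →L[ℝ] ℝ) (y a b : E) :
    leviCivita G y a b = (G y).inverse ((1 / 2 : ℝ) • (fderiv ℝ G y a b + fderiv ℝ G y b a -
      ((fderiv ℝ G y).flip a).flip b)) := by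
  simp [leviCivita]

/-- A smooth field of nondegenerate symmetric bilinear forms on an open subset of a vector
space. -/
structure IsMetricOn (G : E → E →L[ℝ] E →L[ℝ] ℝ) (U : Set E) : Prop where
  isOpen : IsOpen U
  contDiffOn : ContDiffOn ℝ ∞ G U
  symm (y : E) (hy : y ∈ U) (a b : E) : G y a b = G y b a
  nondegenerate (y : E) (hy : y ∈ U) (a : E) (ha : ∀ b, G y a b = 0) : a = 0

/-- The curvature of the metric `G` on a vector space is that of a space form of curvature `k`
at `y`. -/
abbrev HasConstantCurvatureAt (G : E → E →L[ℝ] E →L[ℝ] ℝ) (y : E) (k : ℝ) : Prop :=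
  ∀ a b c d, G y (connectionCurvature (leviCivita G) y a b c) d =
    k * (G y b c * G y a d - G y a c * G y b d)

namespace IsMetricOn

variable {G : E → E →L[ℝ] E →L[ℝ] ℝ} {U : Set E} {y : E}

theorem isInvertible [FiniteDimensional ℝ E] (h : IsMetricOn G U) (hy : y ∈ U) : (G y).IsInvertible := by
  have hinj : Function.Injective ((G y : E →L[ℝ] E →L[ℝ] ℝ) : E →ₗ[ℝ] E →L[ℝ] ℝ) := by
    rw [injective_iff_map_eq_zero]
    intro a ha
    exact h.nondegenerate y hy a fun b ↦ DFunLike.congr_fun ha b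
  have hfin : finrank ℝ E = finrank ℝ (E →L[ℝ] ℝ) := by
    rw [← (LinearMap.toContinuousLinearMap : (E →ₗ[ℝ] ℝ) ≃ₗ[ℝ] _).finrank_eq]
    exact (Subspace.dual_finrank_eq).symm
  refine ⟨(LinearEquiv.ofInjectiveOfFinrankEq _ hinj hfin).toContinuousLinearEquiv, ?_⟩
  ext a b
  rfl

theorem contDiffAt (h : IsMetricOn G U) (hy : y ∈ U) : ContDiffAt ℝ ∞ G y :=
  h.contDiffOn.contDiffAt (h.isOpen.mem_nhds hy)

theorem contDiffAt_leviCivita [FiniteDimensional ℝ E] (h : IsMetricOn G U) (hy : y ∈ U) :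
    ContDiffAt ℝ ∞ (leviCivita G) y := by
  have h1 := (h.contDiffAt hy).fderiv_infty
  have h2 : ContDiffAt ℝ ∞ (fun y ↦ (fderiv ℝ G y).flip) y :=
    (ContinuousLinearMap.flipₗᵢ ℝ E E (E →L[ℝ] ℝ)).toContinuousLinearEquiv.contDiff.contDiffAt.comp
      y h1
  have h3 : ContDiffAt ℝ ∞ (fun y ↦ (G y).inverse) y :=
    ContDiffAt.comp y (h.isInvertible hy).contDiffAt_map_inverse (h.contDiffAt hy)
  unfold leviCivita
  exact ((ContinuousLinearMap.compL ℝ E (E →L[ℝ] ℝ) E).contDiff.contDiffAt.comp y h3).clm_comp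
    (((h1.add h2).sub (contDiffAt_const.clm_comp h2)).const_smul _)

theorem apply_leviCivita [FiniteDimensional ℝ E] (h : IsMetricOn G U) (hy : y ∈ U)
    (a b c : E) :
    G y (leviCivita G y a b) c =
      (fderiv ℝ G y a b c + fderiv ℝ G y b a c - fderiv ℝ G y c a b) / 2 := by
  obtain ⟨e, he⟩ := h.isInvertible hy
  rw [leviCivita_apply, ← he, ContinuousLinearMap.inverse_equiv]
  simp
  ring

theorem fderiv_symm (h : IsMetricOn G U) (hy : y ∈ U) (a b c : E) :
    fderiv ℝ G y a b c = fderiv ℝ G y a c b := by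
  have hd := ((h.contDiffAt hy).differentiableAt (by simp)).hasFDerivAt
  have key : ∀ b c, HasFDerivAt (fun z ↦ G z b c) _ y := fun b c ↦
    (hd.clm_apply (hasFDerivAt_const b y)).clm_apply (hasFDerivAt_const c y)
  have := (key b c).unique ((key c b).congr_of_eventuallyEq
    (Filter.eventually_of_mem (h.isOpen.mem_nhds hy) fun z hz ↦ h.symm z hz b c))
  simpa using DFunLike.congr_fun this a

theorem ext (h : IsMetricOn G U) (hy : y ∈ U) {a b : E} (hab : ∀ c, G y a c = G y b c) :
    a = b :=
  sub_eq_zero.1 (h.nondegenerate y hy _ fun c ↦ by simp [hab c])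

theorem leviCivita_symm [FiniteDimensional ℝ E] (h : IsMetricOn G U) (hy : y ∈ U) (a b : E) :
    leviCivita G y a b = leviCivita G y b a := by
  refine h.ext hy fun c ↦ ?_
  rw [h.apply_leviCivita hy, h.apply_leviCivita hy, h.fderiv_symm hy c a b]
  ring

/-- The Levi-Civita connection is metric. -/
theorem fderiv_apply [FiniteDimensional ℝ E] (h : IsMetricOn G U) (hy : y ∈ U) (a b c : E) :
    fderiv ℝ G y a b c = G y (leviCivita G y a b) c + G y b (leviCivita G y a c) := by
  rw [h.symm y hy b, h.apply_leviCivita hy, h.apply_leviCivita hy, h.fderiv_symm hy a c b,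
    h.fderiv_symm hy c a b, h.fderiv_symm hy b a c]
  ring

theorem fderiv_leviCivita_symm [FiniteDimensional ℝ E] (h : IsMetricOn G U) (hy : y ∈ U) (a b c : E) :
    fderiv ℝ (leviCivita G) y a b c = fderiv ℝ (leviCivita G) y a c b := by
  have hd := ((h.contDiffAt_leviCivita hy).differentiableAt (by simp)).hasFDerivAt
  have key : ∀ b c, HasFDerivAt (fun z ↦ leviCivita G z b c) _ y := fun b c ↦
    (hd.clm_apply (hasFDerivAt_const b y)).clm_apply (hasFDerivAt_const c y)
  have := (key b c).unique ((key c b).congr_of_eventuallyEq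
    (Filter.eventually_of_mem (h.isOpen.mem_nhds hy) fun z hz ↦ h.leviCivita_symm hz b c))
  simpa using DFunLike.congr_fun this a

/-- Metric compatibility differentiated once more. Symmetry of the left side in a and b then yields
the skew symmetry of the curvature in its last two arguments. -/
theorem fderiv_fderiv_apply [FiniteDimensional ℝ E] (h : IsMetricOn G U) (hy : y ∈ U) (a b c d : E) :
    fderiv ℝ (fderiv ℝ G) y b a c d =
      (G y (leviCivita G y b (leviCivita G y a c)) d +
        G y (leviCivita G y a c) (leviCivita G y b d) +
        G y (fderiv ℝ (leviCivita G) y b a c) d) +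
      (G y (leviCivita G y b c) (leviCivita G y a d) +
        G y c (leviCivita G y b (leviCivita G y a d)) +
        G y c (fderiv ℝ (leviCivita G) y b a d)) := by
  have hd := ((h.contDiffAt hy).differentiableAt (by simp)).hasFDerivAt
  have hd2 := ((h.contDiffAt hy).fderiv_infty.differentiableAt (by simp)).hasFDerivAt
  have hΓ := ((h.contDiffAt_leviCivita hy).differentiableAt (by simp)).hasFDerivAt
  have hl := ((hd2.clm_apply (hasFDerivAt_const a y)).clm_apply (hasFDerivAt_const c y)).clm_apply
    (hasFDerivAt_const d y)
  have hΓ2 := fun c ↦ (hΓ.clm_apply (hasFDerivAt_const a y)).clm_apply (hasFDerivAt_const c y)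
  have hr := ((hd.clm_apply (hΓ2 c)).clm_apply (hasFDerivAt_const d y)).add
    ((hd.clm_apply (hasFDerivAt_const c y)).clm_apply (hΓ2 d))
  have := DFunLike.congr_fun (hl.unique (hr.congr_of_eventuallyEq
    (Filter.eventually_of_mem (h.isOpen.mem_nhds hy) fun z hz ↦ h.fderiv_apply hz a c d))) b
  simp [h.fderiv_apply hy] at this
  rw [this]
  ring

/-- The curvature tensor of the Levi-Civita connection has the symmetries of a curvature tensor. -/
theorem isAlgebraicCurvature [FiniteDimensional ℝ E] (h : IsMetricOn G U) (hy : y ∈ U) :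
    IsAlgebraicCurvature fun a b c d ↦ G y (connectionCurvature (leviCivita G) y a b c) d where
  add_left x x' y z w := by simp [connectionCurvature]; ring
  smul_left t x y z w := by simp [connectionCurvature]; ring
  antisymm_left x y z w := by simp [connectionCurvature]
  antisymm_right a b c d := by
    have h1 := h.fderiv_fderiv_apply hy a b c d
    have h2 := h.fderiv_fderiv_apply hy b a c d
    rw [(h.contDiffAt hy).fderiv_fderiv_comm, h1] at h2
    simp only [connectionCurvature, map_add, map_sub, add_apply,
      sub_apply]
    simp only [h.symm y hy c] at h2
    linear_combination -h2
  bianchi a b c d := by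
    have e1 := fun a b c ↦ h.fderiv_leviCivita_symm hy a b c
    have e2 := fun a b ↦ h.leviCivita_symm hy a b
    simp only [connectionCurvature]
    rw [e1 a c b, e1 b a c, e1 c a b, e2 c b, e2 c a, e2 b a]
    simp only [map_add, map_sub, add_apply, sub_apply]
    ring

theorem connectionCurvature_eq [FiniteDimensional ℝ E] (h : IsMetricOn G U) (hy : y ∈ U) {k : ℝ}
    (hk : HasConstantCurvatureAt G y k) (a b c : E) :
    connectionCurvature (leviCivita G) y a b c = k • (G y b c • a - G y a c • b) :=
  h.ext hy fun d ↦ by simp [hk]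

/-- If the curvature is pointwise constant, so that the sectional curvature at `y` is `k y`,
then `k` is differentiable. -/
theorem differentiableAt_of_pointwise_const [FiniteDimensional ℝ E] (h : IsMetricOn G U)
    (hy : y ∈ U) {k : E → ℝ}
    (hk : ∀ z ∈ U, HasConstantCurvatureAt G z (k z))
    {ξ η v₀ : E} (hF : IsNullFrame (G y).toLinearMap₁₂ ξ η v₀) : DifferentiableAt ℝ k y := by
  have hG : ∀ a b, DifferentiableAt ℝ (fun z ↦ G z a b) y := fun a b ↦
    (((h.contDiffAt hy).differentiableAt (by simp)).clm_apply
      (differentiableAt_const a)).clm_apply (differentiableAt_const b)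
  -- Near y, k is a quotient of smooth functions obtained from the fixed vectors ξ, η; the
  -- denominator is -1 at y.
  have hden : DifferentiableAt ℝ (fun z ↦ G z η η * G z ξ ξ - G z ξ η * G z η ξ) y :=
    ((hG _ _).mul (hG _ _)).sub ((hG _ _).mul (hG _ _))
  have hnum : DifferentiableAt ℝ
      (fun z ↦ G z (connectionCurvature (leviCivita G) z ξ η η) ξ) y :=
    (((h.contDiffAt hy).differentiableAt (by simp)).clm_apply
      (((h.contDiffAt_leviCivita hy).connectionCurvature ξ η η).differentiableAt
        (by simp))).clm_apply (differentiableAt_const ξ)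
  have hne : G y η η * G y ξ ξ - G y ξ η * G y η ξ ≠ 0 := by
    have h1 : G y ξ ξ = 0 := hF.left
    have h2 : G y ξ η = 1 := hF.pair
    rw [h1, h.symm y hy η ξ, h2]
    norm_num
  refine (hnum.fun_mul (hden.fun_inv hne)).congr_of_eventuallyEq ?_
  filter_upwards [h.isOpen.mem_nhds hy, hden.continuousAt.eventually_ne hne] with z hz hz0
  rw [hk z hz]
  exact (mul_inv_cancel_right₀ hz0 _).symm

/-- Schur's theorem: if the curvature is pointwise constant, then it is locally constant. -/
theorem fderiv_eq_zero_of_pointwise_const [FiniteDimensional ℝ E] (h : IsMetricOn G U)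
    (hy : y ∈ U) {k : E → ℝ}
    (hk : ∀ z ∈ U, HasConstantCurvatureAt G z (k z))
    {ξ η v₀ : E} (hF : IsNullFrame (G y).toLinearMap₁₂ ξ η v₀) : fderiv ℝ k y = 0 := by
  have dk := (h.differentiableAt_of_pointwise_const hy hk hF).hasFDerivAt
  have hd := ((h.contDiffAt hy).differentiableAt (by simp)).hasFDerivAt
  have dG : ∀ a b, HasFDerivAt (fun z ↦ G z a b) _ y := fun a b ↦
    (hd.clm_apply (hasFDerivAt_const a y)).clm_apply (hasFDerivAt_const b y)
  have hR := fun a b c ↦ h.connectionCurvature_eq hy (hk y hy) a b c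
  have dR : ∀ a b c d, fderiv ℝ (fun z ↦ connectionCurvature (leviCivita G) z a b c) y d =
      fderiv ℝ k y d • (G y b c • a - G y a c • b) +
        k y • ((G y (leviCivita G y d b) c + G y b (leviCivita G y d c)) • a -
          (G y (leviCivita G y d a) c + G y a (leviCivita G y d c)) • b) := by
    intro a b c d
    have h1 := (dk.smul (((dG b c).smul_const a).sub ((dG a c).smul_const b))).congr_of_eventuallyEq
      (Filter.eventually_of_mem (h.isOpen.mem_nhds hy)
        fun z hz ↦ h.connectionCurvature_eq hz (hk z hz) a b c)
    have := DFunLike.congr_fun h1.fderiv d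
    simp [h.fderiv_apply hy] at this
    rw [this]
    module
  -- Second Bianchi for R(a, b)z = k(G(b, z)a - G(a, z)b): since G is parallel and Γ symmetric, only
  -- the terms with dk survive.
  have key : ∀ a b c z, fderiv ℝ k y c • (G y b z • a - G y a z • b) +
      fderiv ℝ k y a • (G y c z • b - G y b z • c) +
      fderiv ℝ k y b • (G y a z • c - G y c z • a) = 0 := by
    intro a b c z
    have := connectionCurvature_bianchi (h.contDiffAt_leviCivita hy) a b c z
    simp only [dR, hR, map_smul, map_sub] at this
    rw [h.leviCivita_symm hy b a, h.leviCivita_symm hy c a, h.leviCivita_symm hy c b] at this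
    rw [← this]
    module
  have f1 : G y ξ ξ = 0 := hF.left
  have f2 : G y η η = 0 := hF.right
  have f3 : G y ξ η = 1 := hF.pair
  have f3' : G y η ξ = 1 := by rw [h.symm y hy, f3]
  have f4 : G y ξ v₀ = 0 := hF.orth_left
  have f5 : G y η v₀ = 0 := hF.orth_right
  have f6 : G y v₀ v₀ ≠ 0 := hF.nonnull
  -- This reads G(v₀, v₀)(dk(ξ)η - dk(η)ξ) = 0, where the third direction v₀ is essential. The next
  -- identity then reduces to dk(c)η = 0.
  have g1 := key η v₀ ξ v₀
  have g2 : ∀ c, _ := fun c ↦ key ξ η c η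
  have e1 : fderiv ℝ k y ξ = 0 := by
    have := congrArg (fun w ↦ G y w ξ) g1
    simpa [f1, f3', f4, f5, f6] using this
  have e2 : fderiv ℝ k y η = 0 := by
    have := congrArg (fun w ↦ G y w η) g1
    simpa [f2, f3, f4, f5, f6] using this
  ext c
  have := congrArg (fun w ↦ G y w ξ) (g2 c)
  simpa [f1, f2, f3, f3', e1, e2] using this

end IsMetricOn

end LeviCivita

/-! ### Isometries, and immersions with zero second fundamental form. -/

namespace IsMetricOn

variable {E : Type*} [NormedAddCommGroup E] [NormedSpace ℝ E] [FiniteDimensional ℝ E]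
  {G G' : E → E →L[ℝ] E →L[ℝ] ℝ} {U U' : Set E} {y : E}

/-- The transformation law of the Christoffel symbols under an isometry `φ`. -/
theorem fderiv_leviCivita (h : IsMetricOn G U) (h' : IsMetricOn G' U') {φ : E → E} (hy : y ∈ U)
    (hφy : φ y ∈ U') (hφ : ContDiffAt ℝ ∞ φ y) (hsurj : Function.Surjective (fderiv ℝ φ y))
    (hG : ∀ᶠ z in nhds y, ∀ a b, G z a b = G' (φ z) (fderiv ℝ φ z a) (fderiv ℝ φ z b)) (a b : E) :
    fderiv ℝ φ y (leviCivita G y a b) =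
      leviCivita G' (φ y) (fderiv ℝ φ y a) (fderiv ℝ φ y b) + fderiv ℝ (fderiv ℝ φ) y a b := by
  have d0 := (hφ.differentiableAt (by simp)).hasFDerivAt
  have d1 := (hφ.fderiv_infty.differentiableAt (by simp)).hasFDerivAt
  have dG := ((h.contDiffAt hy).differentiableAt (by simp)).hasFDerivAt
  have dG' := ((h'.contDiffAt hφy).differentiableAt (by simp)).hasFDerivAt.comp y d0
  have key : ∀ a b c, fderiv ℝ G y a b c =
      fderiv ℝ G' (φ y) (fderiv ℝ φ y a) (fderiv ℝ φ y b) (fderiv ℝ φ y c) +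
      G' (φ y) (fderiv ℝ (fderiv ℝ φ) y a b) (fderiv ℝ φ y c) +
      G' (φ y) (fderiv ℝ φ y b) (fderiv ℝ (fderiv ℝ φ) y a c) := by
    intro a b c
    have hl := (dG.clm_apply (hasFDerivAt_const b y)).clm_apply (hasFDerivAt_const c y)
    have hr := (dG'.clm_apply (d1.clm_apply (hasFDerivAt_const b y))).clm_apply
      (d1.clm_apply (hasFDerivAt_const c y))
    have := DFunLike.congr_fun
      (hl.unique (hr.congr_of_eventuallyEq (hG.mono fun z hz ↦ hz b c))) a
    simp at this
    rw [this]
    ring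
  -- In the Koszul combination of the three derivatives of the pulled-back metric, the second
  -- derivatives of φ add up to 2 G'(D²φ(a, b), dφ c).
  refine h'.ext hφy fun w ↦ ?_
  obtain ⟨c, rfl⟩ := hsurj w
  rw [← hG.self_of_nhds, h.apply_leviCivita hy, map_add, add_apply, h'.apply_leviCivita hφy, key,
    key, key, hφ.fderiv_fderiv_comm b a, hφ.fderiv_fderiv_comm c a, hφ.fderiv_fderiv_comm c b,
    h'.symm _ hφy (fderiv ℝ φ y b), h'.symm _ hφy (fderiv ℝ φ y a)]
  ring

/-- The transformation law of the curvature under an isometry `φ`. -/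
theorem fderiv_connectionCurvature (h : IsMetricOn G U) (h' : IsMetricOn G' U') {φ : E → E}
    (hy : y ∈ U) (hφy : φ y ∈ U') (hφ : ∀ᶠ z in nhds y, ContDiffAt ℝ ∞ φ z)
    (hsurj : ∀ᶠ z in nhds y, Function.Surjective (fderiv ℝ φ z))
    (hG : ∀ᶠ z in nhds y, ∀ a b, G z a b = G' (φ z) (fderiv ℝ φ z a) (fderiv ℝ φ z b))
    (a b c : E) :
    fderiv ℝ φ y (connectionCurvature (leviCivita G) y a b c) =
      connectionCurvature (leviCivita G') (φ y) (fderiv ℝ φ y a) (fderiv ℝ φ y b)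
        (fderiv ℝ φ y c) := by
  refine _root_.fderiv_connectionCurvature hφ.self_of_nhds
    ((h.contDiffAt_leviCivita hy).differentiableAt (by simp))
    ((h'.contDiffAt_leviCivita hφy).differentiableAt (by simp)) ?_ a b c
  filter_upwards [hφ, hsurj, hG.eventually_nhds, h.isOpen.mem_nhds hy,
    hφ.self_of_nhds.continuousAt.preimage_mem_nhds (h'.isOpen.mem_nhds hφy)]
    with z h1 h2 h3 h4 h5 b c
  exact h.fderiv_leviCivita h' h4 h5 h1 h2 h3 b c

end IsMetricOn

/-- If the second fundamental form of the immersion `F` vanishes along `F`, then its tangent space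
is invariant under the curvature. -/
theorem connectionCurvature_mem_range_fderiv {E V : Type*} [NormedAddCommGroup E] [NormedSpace ℝ E]
    [FiniteDimensional ℝ E] [NormedAddCommGroup V] [NormedSpace ℝ V] [FiniteDimensional ℝ V]
    {Γ : E → E →L[ℝ] E →L[ℝ] E} {F : V → E} {o : V} (hF : ContDiffAt ℝ ∞ F o)
    (hinj : Function.Injective (fderiv ℝ F o)) (hΓ : ContDiffAt ℝ ∞ Γ (F o))
    (h : ∀ᶠ u in nhds o, ∀ b c, Γ (F u) (fderiv ℝ F u b) (fderiv ℝ F u c) +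
      fderiv ℝ (fderiv ℝ F) u b c ∈ LinearMap.range (fderiv ℝ F u : V →ₗ[ℝ] E)) (a b c : V) :
    connectionCurvature Γ (F o) (fderiv ℝ F o a) (fderiv ℝ F o b) (fderiv ℝ F o c) ∈
      LinearMap.range (fderiv ℝ F o : V →ₗ[ℝ] E) := by
  -- With L a left inverse of dF at o, (L ∘ dF_u)⁻¹ ∘ L is a left inverse of dF_u for u near o and
  -- is smooth in u.
  obtain ⟨L, hL⟩ := (fderiv ℝ F o : V →ₗ[ℝ] E).exists_leftInverse_of_injective
    (LinearMap.ker_eq_bot.2 hinj)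
  let L' : E →L[ℝ] V := LinearMap.toContinuousLinearMap L
  have hL' : L'.comp (fderiv ℝ F o) = ContinuousLinearMap.id ℝ V := by
    ext x
    exact LinearMap.congr_fun hL x
  have hF1 := hF.fderiv_infty
  have hF2 := hF1.fderiv_infty
  have hLF : ContDiffAt ℝ ∞ (fun u ↦ L'.comp (fderiv ℝ F u)) o := contDiffAt_const.clm_comp hF1
  have hinv0 : (L'.comp (fderiv ℝ F o)).IsInvertible := by
    rw [hL']
    exact ⟨ContinuousLinearEquiv.refl ℝ V, rfl⟩
  have hinv : ContDiffAt ℝ ∞ (fun u ↦ (L'.comp (fderiv ℝ F u)).inverse) o :=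
    ContDiffAt.comp (g := ContinuousLinearMap.inverse) o hinv0.contDiffAt_map_inverse hLF
  have hinvev : ∀ᶠ u in nhds o, (L'.comp (fderiv ℝ F u)).IsInvertible := by
    obtain ⟨e, he⟩ := hinv0
    have := hLF.continuousAt.preimage_mem_nhds (he ▸ e.nhds)
    filter_upwards [this] with u ⟨e', he'⟩
    exact ⟨e', he'⟩
  let B : V → V →L[ℝ] V →L[ℝ] E := fun u ↦
    (((ContinuousLinearMap.compL ℝ V E E).flip (fderiv ℝ F u)).comp (Γ (F u))).comp (fderiv ℝ F u) +
      fderiv ℝ (fderiv ℝ F) u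
  have hB : ∀ u b c, B u b c = Γ (F u) (fderiv ℝ F u b) (fderiv ℝ F u c) +
      fderiv ℝ (fderiv ℝ F) u b c := fun u b c ↦ by simp [B]
  have hBd : ContDiffAt ℝ ∞ B o :=
    ((((ContinuousLinearMap.compL ℝ V E E).flip.contDiff.contDiffAt.comp o hF1).clm_comp
      (ContDiffAt.comp o hΓ hF)).clm_comp hF1).add hF2
  -- The induced connection on V. It is F-related to Γ because B takes values in the range of dF, so
  -- its curvature gives the required preimage.
  let C : V → V →L[ℝ] V →L[ℝ] V := fun u ↦
    (ContinuousLinearMap.compL ℝ V E V ((L'.comp (fderiv ℝ F u)).inverse.comp L')).comp (B u)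
  have hCd : ContDiffAt ℝ ∞ C o :=
    ((ContinuousLinearMap.compL ℝ V E V).contDiff.contDiffAt.comp o
      (hinv.clm_comp contDiffAt_const)).clm_comp hBd
  refine ⟨connectionCurvature C o a b c, ?_⟩
  refine fderiv_connectionCurvature hF (hCd.differentiableAt (by simp))
    (hΓ.differentiableAt (by simp)) ?_ a b c
  filter_upwards [h, hinvev] with u hu hi b c
  obtain ⟨x, hx⟩ := hu b c
  have hC : C u b c = (L'.comp (fderiv ℝ F u)).inverse (L' (B u b c)) := by simp [C]
  rw [← hx, hC, hB, ← hx]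
  have : (L'.comp (fderiv ℝ F u)).inverse (L'.comp (fderiv ℝ F u) x) = x := by
    obtain ⟨e, he⟩ := hi
    rw [← he, ContinuousLinearMap.inverse_equiv]
    simp
  exact congrArg _ this

/-! ### The metric and its curvature read in charts. -/

theorem OpenPartialHomeomorph.MDifferentiable.of_mem_maximalAtlas {E : Type*}
    [NormedAddCommGroup E] [NormedSpace ℝ E] {M : Type*} [TopologicalSpace M] [ChartedSpace E M]
    [IsManifold 𝓘(ℝ, E) ∞ M] {e : OpenPartialHomeomorph M E}
    (he : e ∈ IsManifold.maximalAtlas 𝓘(ℝ, E) ∞ M) : e.MDifferentiable 𝓘(ℝ, E) 𝓘(ℝ, E) :=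
  ⟨(contMDiffOn_of_mem_maximalAtlas he).mdifferentiableOn (by simp),
    (contMDiffOn_symm_of_mem_maximalAtlas he).mdifferentiableOn (by simp)⟩

theorem OpenPartialHomeomorph.contDiffAt_transition {E : Type*} [NormedAddCommGroup E]
    [NormedSpace ℝ E] {M : Type*} [TopologicalSpace M] [ChartedSpace E M]
    {e e' : OpenPartialHomeomorph M E}
    (he : e ∈ IsManifold.maximalAtlas 𝓘(ℝ, E) ∞ M)
    (he' : e' ∈ IsManifold.maximalAtlas 𝓘(ℝ, E) ∞ M) {y : E} (hy : y ∈ e.target)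
    (hy' : e.symm y ∈ e'.source) : ContDiffAt ℝ ∞ (e' ∘ e.symm) y :=
  contMDiffAt_iff_contDiffAt.1 ((contMDiffAt_of_mem_maximalAtlas he' hy').comp y
    (contMDiffAt_symm_of_mem_maximalAtlas he hy))

namespace PseudoRiemannianMetric

variable {E : Type v} [NormedAddCommGroup E] [NormedSpace ℝ E]
  {M : Type u} [TopologicalSpace M] [ChartedSpace E M] [IsManifold 𝓘(ℝ, E) ∞ M]
  (g : PseudoRiemannianMetric E M) {e e' : OpenPartialHomeomorph M E}

theorem inChart_mfderiv (he : e ∈ IsManifold.maximalAtlas 𝓘(ℝ, E) ∞ M) {p : M}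
    (hp : p ∈ e.source) (a b : TangentSpace 𝓘(ℝ, E) p) :
    g.inChart e (e p) (mfderiv 𝓘(ℝ, E) 𝓘(ℝ, E) e p a) (mfderiv 𝓘(ℝ, E) 𝓘(ℝ, E) e p b) =
      g.form p a b := by
  have h1 := (OpenPartialHomeomorph.MDifferentiable.of_mem_maximalAtlas he).symm_comp_deriv hp
  have h2 : ∀ a : TangentSpace 𝓘(ℝ, E) p, (mfderiv 𝓘(ℝ, E) 𝓘(ℝ, E) e.symm (e p)
      (mfderiv 𝓘(ℝ, E) 𝓘(ℝ, E) e p a) : E) = a := fun a ↦ DFunLike.congr_fun h1 a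
  -- The tangent spaces at e.symm (e p) and at p are different types; viewing the forms on E lets
  -- the equality of base points be substituted.
  have h3 : ∀ q, q = p → ∀ a b : E, (g.form q : E →L[ℝ] E →L[ℝ] ℝ) a b =
      (g.form p : E →L[ℝ] E →L[ℝ] ℝ) a b := by
    rintro q rfl a b; rfl
  refine (h3 _ (e.left_inv hp) _ _).trans ?_
  exact congrArg₂ (fun a b : E ↦ (g.form p : E →L[ℝ] E →L[ℝ] ℝ) a b) (h2 a) (h2 b)

theorem contDiffOn_inChart_apply (he : e ∈ IsManifold.maximalAtlas 𝓘(ℝ, E) ∞ M) (a b : E) :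
    ContDiffOn ℝ ∞ (fun y ↦ g.inChart e y a b) e.target := by
  have hs := contMDiffOn_symm_of_mem_maximalAtlas he
  -- A constant field pushed forward by the tangent map of e.symm is a smooth vector field along
  -- e.symm, and may be inserted in the smooth section `g.form`.
  have hfield : ∀ a : E, ContMDiffOn 𝓘(ℝ, E) (𝓘(ℝ, E).prod 𝓘(ℝ, E)) ∞
      (fun y ↦ Bundle.TotalSpace.mk' E (E := fun p : M ↦ TangentSpace 𝓘(ℝ, E) p) (e.symm y)
        (mfderiv 𝓘(ℝ, E) 𝓘(ℝ, E) e.symm y a)) e.target := by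
    intro a
    have h1 := hs.contMDiffOn_tangentMapWithin (m := ∞) (by simp) e.open_target.uniqueMDiffOn
    have h2 : ContMDiffOn 𝓘(ℝ, E) (𝓘(ℝ, E).prod 𝓘(ℝ, E)) ∞
        (fun y : E ↦ (⟨y, a⟩ : TangentBundle 𝓘(ℝ, E) E)) e.target :=
      contMDiffOn_vectorSpace_iff_contDiffOn.2 contDiffOn_const
    refine (h1.comp h2 fun y hy ↦ hy).congr fun y hy ↦ ?_
    simp only [Function.comp, tangentMapWithin, mfderivWithin_of_isOpen e.open_target hy]
  have h : ContMDiffOn 𝓘(ℝ, E) (𝓘(ℝ, E).prod 𝓘(ℝ)) ∞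
      (fun y ↦ Bundle.TotalSpace.mk' ℝ (E := Bundle.Trivial M ℝ) (e.symm y)
        (g.form (e.symm y) (mfderiv 𝓘(ℝ, E) 𝓘(ℝ, E) e.symm y a)
          (mfderiv 𝓘(ℝ, E) 𝓘(ℝ, E) e.symm y b))) e.target :=
    ContMDiffOn.clm_bundle_apply₂ (F₁ := E) (F₂ := E) (g.contMDiff.comp_contMDiffOn hs)
      (hfield a) (hfield b)
  rw [← contMDiffOn_iff_contDiffOn]
  intro y hy
  have := h y hy
  simp only [Bundle.contMDiffWithinAt_totalSpace] at this
  exact this.2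

theorem isMetricOn_inChart [FiniteDimensional ℝ E]
    (he : e ∈ IsManifold.maximalAtlas 𝓘(ℝ, E) ∞ M) :
    IsMetricOn (g.inChart e) e.target where
  isOpen := e.open_target
  contDiffOn := contDiffOn_clm_apply.2 fun a ↦ contDiffOn_clm_apply.2 fun b ↦
    g.contDiffOn_inChart_apply he a b
  symm y hy a b := g.symm (e.symm y) (mfderiv 𝓘(ℝ, E) 𝓘(ℝ, E) e.symm y a)
    (mfderiv 𝓘(ℝ, E) 𝓘(ℝ, E) e.symm y b)
  nondegenerate y hy a ha := by
    have h := (OpenPartialHomeomorph.MDifferentiable.of_mem_maximalAtlas he).symm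
    have h0 : mfderiv 𝓘(ℝ, E) 𝓘(ℝ, E) e.symm y a = 0 := by
      refine g.nondegenerate (e.symm y) _ fun w ↦ ?_
      obtain ⟨b, rfl⟩ := h.mfderiv_surjective hy w
      exact ha b
    exact h.mfderiv_injective hy (h0.trans (map_zero (mfderiv 𝓘(ℝ, E) 𝓘(ℝ, E) e.symm y)).symm)

theorem christoffel_eq (e : OpenPartialHomeomorph M E) (y a b : E) :
    g.christoffel e y a b = leviCivita (g.inChart e) y a b :=
  (leviCivita_apply _ _ _ _).symm

theorem curvatureInChart_eq [FiniteDimensional ℝ E]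
    (he : e ∈ IsManifold.maximalAtlas 𝓘(ℝ, E) ∞ M) {y : E}
    (hy : y ∈ e.target) (a b c : E) :
    g.curvatureInChart e y a b c = connectionCurvature (leviCivita (g.inChart e)) y a b c := by
  have hd := (((g.isMetricOn_inChart he).contDiffAt_leviCivita hy).differentiableAt
    (by simp)).hasFDerivAt
  have h : ∀ b c a, fderiv ℝ (fun z ↦ g.christoffel e z b c) y a =
      fderiv ℝ (leviCivita (g.inChart e)) y a b c := by
    intro b c a
    simp only [christoffel_eq]
    have := ((hd.clm_apply (hasFDerivAt_const b y)).clm_apply (hasFDerivAt_const c y)).fderiv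
    rw [this]
    simp
  simp only [curvatureInChart, connectionCurvature, h]
  simp only [christoffel_eq]

theorem fderiv_transition (he : e ∈ IsManifold.maximalAtlas 𝓘(ℝ, E) ∞ M)
    (he' : e' ∈ IsManifold.maximalAtlas 𝓘(ℝ, E) ∞ M) {y : E} (hy : y ∈ e.target)
    (hy' : e.symm y ∈ e'.source) (a : E) : fderiv ℝ (e' ∘ e.symm) y a =
      mfderiv 𝓘(ℝ, E) 𝓘(ℝ, E) e' (e.symm y) (mfderiv 𝓘(ℝ, E) 𝓘(ℝ, E) e.symm y a) := by
  have h := (OpenPartialHomeomorph.MDifferentiable.of_mem_maximalAtlas he)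
  have h' := (OpenPartialHomeomorph.MDifferentiable.of_mem_maximalAtlas he')
  rw [← mfderiv_eq_fderiv, mfderiv_comp y (h'.mdifferentiableAt hy') (h.mdifferentiableAt_symm hy)]
  rfl

theorem surjective_fderiv_transition (he : e ∈ IsManifold.maximalAtlas 𝓘(ℝ, E) ∞ M)
    (he' : e' ∈ IsManifold.maximalAtlas 𝓘(ℝ, E) ∞ M) {y : E} (hy : y ∈ e.target)
    (hy' : e.symm y ∈ e'.source) : Function.Surjective (fderiv ℝ (e' ∘ e.symm) y) := by
  intro w
  obtain ⟨b, hb⟩ := (OpenPartialHomeomorph.MDifferentiable.of_mem_maximalAtlas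
    he').mfderiv_surjective hy' w
  obtain ⟨a, ha⟩ := (OpenPartialHomeomorph.MDifferentiable.of_mem_maximalAtlas
    he).symm.mfderiv_surjective hy b
  exact ⟨a, (fderiv_transition he he' hy hy' a).trans ((congrArg _ ha).trans hb)⟩

theorem inChart_transition (he : e ∈ IsManifold.maximalAtlas 𝓘(ℝ, E) ∞ M)
    (he' : e' ∈ IsManifold.maximalAtlas 𝓘(ℝ, E) ∞ M) {y : E} (hy : y ∈ e.target)
    (hy' : e.symm y ∈ e'.source) (a b : E) : g.inChart e y a b =
      g.inChart e' (e' (e.symm y)) (fderiv ℝ (e' ∘ e.symm) y a)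
        (fderiv ℝ (e' ∘ e.symm) y b) := by
  rw [fderiv_transition he he' hy hy', fderiv_transition he he' hy hy']
  exact (g.inChart_mfderiv he' hy' _ _).symm

/-- The transition map is an isometry between the two coordinate metrics, so it carries one
curvature to the other. -/
theorem fderiv_transition_curvature [FiniteDimensional ℝ E]
    (he : e ∈ IsManifold.maximalAtlas 𝓘(ℝ, E) ∞ M)
    (he' : e' ∈ IsManifold.maximalAtlas 𝓘(ℝ, E) ∞ M) {y : E} (hy : y ∈ e.target)
    (hy' : e.symm y ∈ e'.source) (a b c : E) :
    fderiv ℝ (e' ∘ e.symm) y (connectionCurvature (leviCivita (g.inChart e)) y a b c) =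
      connectionCurvature (leviCivita (g.inChart e')) (e' (e.symm y))
        (fderiv ℝ (e' ∘ e.symm) y a) (fderiv ℝ (e' ∘ e.symm) y b)
        (fderiv ℝ (e' ∘ e.symm) y c) := by
  have hev : ∀ᶠ z in nhds y, z ∈ e.target ∧ e.symm z ∈ e'.source :=
    (e.open_target.mem_nhds hy |> fun h ↦ Filter.inter_mem h
      ((e.symm.continuousAt hy).preimage_mem_nhds (e'.open_source.mem_nhds hy')))
  exact (g.isMetricOn_inChart he).fderiv_connectionCurvature (g.isMetricOn_inChart he') hy
    (e'.map_source hy') (hev.mono fun z hz ↦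
      OpenPartialHomeomorph.contDiffAt_transition he he' hz.1 hz.2)
    (hev.mono fun z hz ↦ surjective_fderiv_transition he he' hz.1 hz.2)
    (hev.mono fun z hz ↦ g.inChart_transition he he' hz.1 hz.2) a b c

end PseudoRiemannianMetric

/-! ### Totally geodesic surfaces. -/

theorem deriv_deriv_comp {V E : Type*} [NormedAddCommGroup V] [NormedSpace ℝ V]
    [NormedAddCommGroup E] [NormedSpace ℝ E] {F : V → E} {σ : ℝ → V} {t : ℝ}
    (hσ : ContDiffAt ℝ ∞ σ t) (hF : ContDiffAt ℝ ∞ F (σ t)) :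
    deriv (deriv (F ∘ σ)) t = fderiv ℝ (fderiv ℝ F) (σ t) (deriv σ t) (deriv σ t) +
      fderiv ℝ F (σ t) (deriv (deriv σ) t) := by
  have hF' : ∀ᶠ v in nhds (σ t), DifferentiableAt ℝ F v :=
    ((hF.of_le (m := 1) (by simp)).eventually (by simp)).mono
      fun v hv ↦ hv.differentiableAt (by simp)
  have hσ' : ∀ᶠ r in nhds t, DifferentiableAt ℝ σ r :=
    ((hσ.of_le (m := 1) (by simp)).eventually (by simp)).mono
      fun v hv ↦ hv.differentiableAt (by simp)
  have h1 : deriv (F ∘ σ) =ᶠ[nhds t] fun r ↦ fderiv ℝ F (σ r) (deriv σ r) := by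
    filter_upwards [hσ', hσ.continuousAt.eventually hF'] with r h2 h3
    exact fderiv_comp_deriv r h3 h2
  rw [h1.deriv_eq]
  have d1 := (hσ.differentiableAt (by simp)).hasDerivAt
  have d2 : HasDerivAt (deriv σ) (deriv (deriv σ) t) t := by
    have : ContDiffAt ℝ 1 (deriv σ) t := by
      have := hσ.fderiv_infty
      have := this.clm_apply (contDiffAt_const (c := (1 : ℝ)))
      exact this.of_le (by simp)
    exact (this.differentiableAt (by simp)).hasDerivAt
  have d3 := ((hF.fderiv_infty.differentiableAt (by simp)).hasFDerivAt).comp_hasDerivAt t d1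
  exact (d3.clm_apply d2).deriv

/-- A smooth curve in a manifold, given by its initial velocity, read in a chart. -/
theorem hasDerivAt_comp_of_tangentMap_eq {E : Type*} [NormedAddCommGroup E] [NormedSpace ℝ E]
    {N : Type*} [TopologicalSpace N] [ChartedSpace E N] {c : ℝ → N} {q : N}
    {w : TangentSpace 𝓘(ℝ, E) q} (hc : MDifferentiableAt 𝓘(ℝ, ℝ) 𝓘(ℝ, E) c 0)
    (h : tangentMap 𝓘(ℝ, ℝ) 𝓘(ℝ, E) c ⟨0, (1 : ℝ)⟩ = (⟨q, w⟩ : TangentBundle 𝓘(ℝ, E) N))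
    {φ : N → E} (hφ : MDifferentiableAt 𝓘(ℝ, E) 𝓘(ℝ, E) φ q) :
    c 0 = q ∧ HasDerivAt (φ ∘ c) (mfderiv 𝓘(ℝ, E) 𝓘(ℝ, E) φ q w : E) 0 := by
  have h0 : c 0 = q := congrArg Bundle.TotalSpace.proj h
  refine ⟨h0, ?_⟩
  have h1 : (mfderiv 𝓘(ℝ, E) 𝓘(ℝ, E) φ (c 0) (mfderiv 𝓘(ℝ, ℝ) 𝓘(ℝ, E) c 0 (1 : ℝ)) : E) =
      mfderiv 𝓘(ℝ, E) 𝓘(ℝ, E) φ q w :=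
    congrArg (fun z : TangentBundle 𝓘(ℝ, E) N ↦ (mfderiv 𝓘(ℝ, E) 𝓘(ℝ, E) φ z.1 z.2 : E)) h
  rw [← h0] at hφ
  have h2 : ∀ L : ℝ →L[ℝ] E, HasMFDerivAt 𝓘(ℝ, ℝ) 𝓘(ℝ, E) (φ ∘ c) 0 L →
      HasDerivAt (φ ∘ c) (L 1) 0 := by
    intro L hL
    have hL' : HasFDerivAt (φ ∘ c) L 0 := hasMFDerivAt_iff_hasFDerivAt.1 hL
    exact hL'.hasDerivAt
  rw [← h1]
  exact h2 _ (hφ.hasMFDerivAt.comp 0 hc.hasMFDerivAt)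

namespace PseudoRiemannianMetric

variable {E : Type v} [NormedAddCommGroup E] [NormedSpace ℝ E] [FiniteDimensional ℝ E]
  {M : Type u} [TopologicalSpace M] [ChartedSpace E M] [IsManifold 𝓘(ℝ, E) ∞ M]
  {g : PseudoRiemannianMetric E M} {e : OpenPartialHomeomorph M E}
  {N : Type u} [TopologicalSpace N] [ChartedSpace (EuclideanSpace ℝ (Fin 2)) N]
  [IsManifold (𝓡 2) ∞ N] {f : N → M} {q : N}

/-- The second fundamental form of a totally geodesic surface vanishes. -/
theorem IsTotallyGeodesic.leviCivita_add_mem_range (hgeo : g.IsTotallyGeodesic f)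
    (hf : ContMDiff (𝓡 2) 𝓘(ℝ, E) ∞ f) (he : e ∈ IsManifold.maximalAtlas 𝓘(ℝ, E) ∞ M)
    {φ : OpenPartialHomeomorph N (EuclideanSpace ℝ (Fin 2))}
    (hφ : φ ∈ IsManifold.maximalAtlas (𝓡 2) ∞ N) {u : EuclideanSpace ℝ (Fin 2)}
    (hu : u ∈ φ.target) (hue : f (φ.symm u) ∈ e.source) (b c : EuclideanSpace ℝ (Fin 2)) :
    leviCivita (g.inChart e) (e (f (φ.symm u))) (fderiv ℝ (e ∘ f ∘ φ.symm) u b)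
        (fderiv ℝ (e ∘ f ∘ φ.symm) u c) + fderiv ℝ (fderiv ℝ (e ∘ f ∘ φ.symm)) u b c ∈
      LinearMap.range
        (fderiv ℝ (e ∘ f ∘ φ.symm) u : EuclideanSpace ℝ (Fin 2) →ₗ[ℝ] E) := by
  set F := e ∘ f ∘ φ.symm with hFdef
  have hF : ContDiffAt ℝ ∞ F u := contMDiffAt_iff_contDiffAt.1
    ((contMDiffAt_of_mem_maximalAtlas he hue).comp u
      (hf.contMDiffAt.comp u (contMDiffAt_symm_of_mem_maximalAtlas hφ hu)))
  have hsymm := fun b c ↦ (g.isMetricOn_inChart he).leviCivita_symm (e.map_source hue) b c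
  -- Geodesics only give the diagonal values of the second fundamental form.
  have quad : ∀ w, leviCivita (g.inChart e) (e (f (φ.symm u))) (fderiv ℝ F u w)
      (fderiv ℝ F u w) + fderiv ℝ (fderiv ℝ F) u w w ∈
      LinearMap.range (fderiv ℝ F u : EuclideanSpace ℝ (Fin 2) →ₗ[ℝ] E) := by
    intro w
    have hφm := OpenPartialHomeomorph.MDifferentiable.of_mem_maximalAtlas hφ
    have hus := φ.map_target hu
    obtain ⟨w', hw'⟩ := hφm.mfderiv_surjective hus w
    obtain ⟨ε, hε, c, hc, hT, hG⟩ := hgeo (φ.symm u) w'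
    have h0 : (0 : ℝ) ∈ Set.Ioo (-ε) ε := by constructor <;> linarith
    have hc0 := hc.contMDiffAt (Ioo_mem_nhds h0.1 h0.2)
    obtain ⟨hcq, hd⟩ := hasDerivAt_comp_of_tangentMap_eq (hc0.mdifferentiableAt (by simp)) hT
      (hφm.mdifferentiableAt hus)
    rw [hw'] at hd
    have hσ0 : (φ ∘ c) 0 = u := by simp [hcq, φ.right_inv hu]
    have hσ : ContDiffAt ℝ ∞ (φ ∘ c) 0 := contMDiffAt_iff_contDiffAt.1
      ((contMDiffAt_of_mem_maximalAtlas hφ (by rw [hcq]; exact hus)).comp 0 hc0)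
    have hev : e ∘ f ∘ c =ᶠ[nhds 0] F ∘ (φ ∘ c) := by
      filter_upwards [hc0.continuousAt.preimage_mem_nhds
        (φ.open_source.mem_nhds (by rw [hcq]; exact hus))] with t ht
      simp only [hFdef, Function.comp]
      rw [φ.left_inv ht]
    have hev' := hev.deriv
    have key := hG.2 0 h0 e he (by simpa [hcq] using hue)
    rw [hev'.deriv_eq, hev'.self_of_nhds, deriv_deriv_comp hσ (by rw [hσ0]; exact hF), hσ0,
      fderiv_comp_deriv 0 (by rw [hσ0]; exact hF.differentiableAt (by simp)) hd.differentiableAt,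
      hd.deriv, hσ0, christoffel_eq, Function.comp, hcq] at key
    -- With σ = φ ∘ c, the geodesic equation for F ∘ σ says Γ(dF w, dF w) + D²F(w, w) + dF(σ'') = 0.
    refine ⟨-deriv (deriv (φ ∘ c)) 0, ?_⟩
    rw [map_neg]
    rw [neg_eq_iff_add_eq_zero, ← key]
    simp only [ContinuousLinearMap.coe_coe]
    abel
  -- Polarization; the form is symmetric since Γ and D²F are.
  have h1 := quad (b + c)
  have h2 := quad b
  have h3 := quad c
  have h4 := Submodule.smul_mem _ (1 / 2 : ℝ) (Submodule.sub_mem _ (Submodule.sub_mem _ h1 h2) h3)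
  convert h4 using 1
  simp only [map_add, add_apply]
  rw [hsymm (fderiv ℝ F u c), hF.fderiv_fderiv_comm c b]
  module

/-- The tangent planes of a totally geodesic surface are invariant under the curvature. -/
theorem IsTotallyGeodesic.curvature_mem (hgeo : g.IsTotallyGeodesic f)
    (hf : ContMDiff (𝓡 2) 𝓘(ℝ, E) ∞ f) (he : e ∈ IsManifold.maximalAtlas 𝓘(ℝ, E) ∞ M)
    (hq : f q ∈ e.source) (hrank : finrank ℝ (tangentPlane (E := E) f q) = 2)
    {x y z : TangentSpace 𝓘(ℝ, E) (f q)} (hx : x ∈ tangentPlane f q)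
    (hy : y ∈ tangentPlane f q) (hz : z ∈ tangentPlane f q) :
    ∃ w ∈ tangentPlane (E := E) f q,
      connectionCurvature (leviCivita (g.inChart e)) (e (f q))
        (mfderiv 𝓘(ℝ, E) 𝓘(ℝ, E) e (f q) x) (mfderiv 𝓘(ℝ, E) 𝓘(ℝ, E) e (f q) y)
        (mfderiv 𝓘(ℝ, E) 𝓘(ℝ, E) e (f q) z) = mfderiv 𝓘(ℝ, E) 𝓘(ℝ, E) e (f q) w := by
  set φ := chartAt (EuclideanSpace ℝ (Fin 2)) q
  have hφ : φ ∈ IsManifold.maximalAtlas (𝓡 2) ∞ N := IsManifold.chart_mem_maximalAtlas q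
  have hqs : q ∈ φ.source := mem_chart_source _ q
  have hqt := φ.map_source hqs
  have hql := φ.left_inv hqs
  have hφm := OpenPartialHomeomorph.MDifferentiable.of_mem_maximalAtlas hφ
  have hem := OpenPartialHomeomorph.MDifferentiable.of_mem_maximalAtlas he
  set F := e ∘ f ∘ φ.symm with hFdef
  have hFq : F (φ q) = e (f q) := by simp [hFdef, hql]
  have hF : ContDiffAt ℝ ∞ F (φ q) := contMDiffAt_iff_contDiffAt.1
    ((contMDiffAt_of_mem_maximalAtlas he (by rw [Function.comp, hql]; exact hq)).comp (φ q)
      (hf.contMDiffAt.comp (φ q) (contMDiffAt_symm_of_mem_maximalAtlas hφ hqt)))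
  have hD : ∀ v : TangentSpace (𝓡 2) q, fderiv ℝ F (φ q) (mfderiv (𝓡 2) (𝓡 2) φ q v) =
      mfderiv 𝓘(ℝ, E) 𝓘(ℝ, E) e (f q) (mfderiv (𝓡 2) 𝓘(ℝ, E) f q v) := by
    intro v
    have h1 := ((hF.differentiableAt (by simp)).hasFDerivAt.hasMFDerivAt).comp q
      (hφm.mdifferentiableAt hqs).hasMFDerivAt
    have h2 := (hem.mdifferentiableAt hq).hasMFDerivAt.comp q
      (hf.mdifferentiableAt (by simp)).hasMFDerivAt
    have hev : e ∘ f =ᶠ[nhds q] F ∘ φ := by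
      filter_upwards [φ.open_source.mem_nhds hqs] with t ht
      simp only [hFdef, Function.comp]
      rw [φ.left_inv ht]
    exact DFunLike.congr_fun (hasMFDerivAt_unique h1 (h2.congr_of_eventuallyEq hev.symm)) v
  have hfinj : Function.Injective (mfderiv (𝓡 2) 𝓘(ℝ, E) f q) := by
    have : FiniteDimensional ℝ (TangentSpace (𝓡 2) q) :=
      inferInstanceAs (FiniteDimensional ℝ (EuclideanSpace ℝ (Fin 2)))
    have h1 := LinearMap.finrank_range_add_finrank_ker
      (mfderiv (𝓡 2) 𝓘(ℝ, E) f q : TangentSpace (𝓡 2) q →ₗ[ℝ] TangentSpace 𝓘(ℝ, E) (f q))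
    have h2 : finrank ℝ (TangentSpace (𝓡 2) q) = 2 :=
      finrank_euclideanSpace_fin (𝕜 := ℝ) (n := 2)
    have h3 : finrank ℝ (LinearMap.range (mfderiv (𝓡 2) 𝓘(ℝ, E) f q :
      TangentSpace (𝓡 2) q →ₗ[ℝ] TangentSpace 𝓘(ℝ, E) (f q))) = 2 := hrank
    have h4 : finrank ℝ (LinearMap.ker (mfderiv (𝓡 2) 𝓘(ℝ, E) f q :
      TangentSpace (𝓡 2) q →ₗ[ℝ] TangentSpace 𝓘(ℝ, E) (f q))) = 0 := by omega
    exact LinearMap.ker_eq_bot.1 (Submodule.finrank_eq_zero.1 h4)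
  have hFinj : Function.Injective (fderiv ℝ F (φ q)) := by
    intro a b hab
    obtain ⟨a', rfl⟩ := hφm.mfderiv_surjective hqs a
    obtain ⟨b', rfl⟩ := hφm.mfderiv_surjective hqs b
    have := (hD a').symm.trans (hab.trans (hD b'))
    rw [hfinj (hem.mfderiv_injective hq this)]
  have hev : ∀ᶠ u in nhds (φ q), u ∈ φ.target ∧ f (φ.symm u) ∈ e.source :=
    Filter.inter_mem (φ.open_target.mem_nhds hqt)
      ((hf.continuous.continuousAt.comp (φ.symm.continuousAt hqt)).preimage_mem_nhds
        (e.open_source.mem_nhds (by simpa [hql] using hq)))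
  obtain ⟨a, rfl⟩ := hx
  obtain ⟨b, rfl⟩ := hy
  obtain ⟨c, rfl⟩ := hz
  obtain ⟨r, hr⟩ := connectionCurvature_mem_range_fderiv (Γ := leviCivita (g.inChart e)) hF hFinj
    (by rw [hFq]; exact (g.isMetricOn_inChart he).contDiffAt_leviCivita (e.map_source hq))
    (hev.mono fun u hu b c ↦ hgeo.leviCivita_add_mem_range hf he hφ hu.1 hu.2 b c)
    (mfderiv (𝓡 2) (𝓡 2) φ q a) (mfderiv (𝓡 2) (𝓡 2) φ q b) (mfderiv (𝓡 2) (𝓡 2) φ q c)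
  obtain ⟨r', rfl⟩ := hφm.mfderiv_surjective hqs r
  refine ⟨_, ⟨r', rfl⟩, ?_⟩
  refine Eq.trans ?_ (hr.symm.trans (hD r'))
  rw [hD a, hD b, hD c, hFq]
  rfl

end PseudoRiemannianMetric

/-! ### Weakly isotropic planes and pointwise constancy of the curvature. -/

namespace PseudoRiemannianMetric

variable {E : Type v} [NormedAddCommGroup E] [NormedSpace ℝ E]
  {M : Type u} [TopologicalSpace M] [ChartedSpace E M] [IsManifold 𝓘(ℝ, E) ∞ M]
  {g : PseudoRiemannianMetric E M} {e e' : OpenPartialHomeomorph M E}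

theorem rankOn_def (p : M) (P : Submodule ℝ (TangentSpace 𝓘(ℝ, E) p)) :
    g.rankOn p P = finrank ℝ (LinearMap.range
      ((g.form p).toLinearMap₁₂.domRestrict₁₂ P P)) :=
  rfl

/-- The span of a null vector and a non-null vector orthogonal to it is weakly isotropic. -/
theorem isWeaklyIsotropicPlane_span {p : M} {x u : TangentSpace 𝓘(ℝ, E) p} (hx : x ≠ 0)
    (hxx : g.form p x x = 0) (hxu : g.form p x u = 0) (huu : g.form p u u ≠ 0) :
    g.IsWeaklyIsotropicPlane p (Submodule.span ℝ {x, u}) := by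
  have hux : g.form p u x = 0 := by rw [g.symm, hxu]
  constructor
  · have hli : LinearIndependent ℝ ![x, u] := by
      rw [LinearIndependent.pair_iff]
      intro a b hab
      have h1 := congrArg (fun z ↦ g.form p z u) hab
      have hb : b = 0 := by simpa [hxu, huu] using h1
      subst hb
      simpa [hx] using hab
    have := finrank_span_eq_card hli
    rwa [Matrix.range_cons_cons_empty, Fintype.card_fin] at this
  · rw [rankOn_def]
    set P : Submodule ℝ (TangentSpace 𝓘(ℝ, E) p) := Submodule.span ℝ {x, u} with hP
    set B := (g.form p).toLinearMap₁₂.domRestrict₁₂ P P with hB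
    have hBa : ∀ a b : P, B a b = g.form p a b := fun a b ↦ rfl
    have huP : u ∈ P := Submodule.subset_span (by simp)
    -- Since x is in the radical of the plane, only the functional g(u, ·) contributes.
    have hrange : LinearMap.range B = Submodule.span ℝ {B ⟨u, huP⟩} := by
      apply le_antisymm
      · rintro _ ⟨⟨z, hz⟩, rfl⟩
        obtain ⟨a, b, rfl⟩ := Submodule.mem_span_pair.1 hz
        refine Submodule.mem_span_singleton.2 ⟨b, ?_⟩
        ext ⟨w, hw⟩
        obtain ⟨c, d, rfl⟩ := Submodule.mem_span_pair.1 hw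
        rw [LinearMap.smul_apply, hBa, hBa]
        simp [hxx, hxu, hux]
      · rw [Submodule.span_singleton_le_iff_mem]
        exact ⟨_, rfl⟩
    rw [hrange]
    apply finrank_span_singleton
    intro h
    apply huu
    have := LinearMap.congr_fun h ⟨u, huP⟩
    rwa [hBa] at this

/-- The Gram determinant of a basis of a nondegenerate plane does not vanish. -/
theorem IsNondegeneratePlane.gram_ne_zero {p : M} {x y : TangentSpace 𝓘(ℝ, E) p}
    (h : g.IsNondegeneratePlane p (Submodule.span ℝ {x, y})) :
    g.form p x x * g.form p y y - g.form p x y ^ 2 ≠ 0 := by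
  obtain ⟨h1, h2⟩ := h
  rw [rankOn_def] at h2
  set P : Submodule ℝ (TangentSpace 𝓘(ℝ, E) p) := Submodule.span ℝ {x, y} with hP
  set B := (g.form p).toLinearMap₁₂.domRestrict₁₂ P P with hB
  have hBa : ∀ a b : P, B a b = g.form p a b := fun a b ↦ rfl
  have : FiniteDimensional ℝ P := Module.finite_of_finrank_pos (by omega)
  have hker : LinearMap.ker B = ⊥ := by
    have := LinearMap.finrank_range_add_finrank_ker B
    exact Submodule.finrank_eq_zero.1 (by omega)
  have hinj : ∀ a b : ℝ, a * g.form p x x + b * g.form p x y = 0 →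
      a * g.form p x y + b * g.form p y y = 0 → a • x + b • y = 0 := by
    intro a b h3 h4
    have hm : a • x + b • y ∈ P := Submodule.mem_span_pair.2 ⟨a, b, rfl⟩
    have h5 : B ⟨_, hm⟩ = 0 := by
      ext ⟨w, hw⟩
      obtain ⟨c, d, rfl⟩ := Submodule.mem_span_pair.1 hw
      rw [hBa]
      simp only [map_add, map_smul, add_apply, smul_apply, smul_eq_mul, LinearMap.zero_apply,
        g.symm p y x]
      linear_combination c * h3 + d * h4
    have := LinearMap.ker_eq_bot'.1 hker _ h5
    exact congrArg Subtype.val this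
  have hli : LinearIndependent ℝ ![x, y] := by
    rw [linearIndependent_iff_card_eq_finrank_span, Matrix.range_cons_cons_empty, Fintype.card_fin]
    exact h1.symm
  rw [LinearIndependent.pair_iff] at hli
  intro h0
  -- If the determinant vanishes, (g(x, y), -g(x, x)) is in the kernel of the Gram matrix.
  -- Independence gives g(x, x) = g(x, y) = 0, and then x itself lies in the radical.
  have e1 := hli _ _ (hinj (g.form p x y) (-g.form p x x) (by ring) (by linear_combination -h0))
  have e2 := hli _ _ (hinj (g.form p y y) (-g.form p x y) (by linear_combination h0) (by ring))
  have e3 := hli _ _ (hinj 1 0 (by linarith [e1.2]) (by linarith [e1.1]))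
  exact one_ne_zero e3.1

/-- Every tangent space of an indefinite metric in dimension at least three has a null frame. -/
theorem HasSignature.exists_isNullFrame {s : ℕ} (hg : g.HasSignature s) (hn : 3 ≤ finrank ℝ E)
    (hs : 0 < s) (hsn : s < finrank ℝ E) (p : M) :
    ∃ ξ η v : TangentSpace 𝓘(ℝ, E) p, IsNullFrame (g.form p).toLinearMap₁₂ ξ η v := by
  obtain ⟨b, hb⟩ := hg p
  have hi : 0 < finrank ℝ E := by omega
  have hj : finrank ℝ E - 1 < finrank ℝ E := by omega
  have hl : 1 < finrank ℝ E := by omega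
  -- Index 0 has sign -1 because 0 < s, and the last index has sign +1 because s < n. Index 1
  -- differs from both as n ≥ 3; its sign is irrelevant.
  set i : Fin (finrank ℝ E) := ⟨0, hi⟩ with hidef
  set j : Fin (finrank ℝ E) := ⟨finrank ℝ E - 1, hj⟩ with hjdef
  set l : Fin (finrank ℝ E) := ⟨1, hl⟩ with hldef
  have hij : i ≠ j := by simp [hidef, hjdef]; omega
  have hil : i ≠ l := by simp [hidef, hldef]
  have hjl : j ≠ l := by simp [hjdef, hldef]; omega
  have f1 : g.form p (b i) (b i) = -1 := by rw [hb]; simp [hidef, hs]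
  have f2 : g.form p (b j) (b j) = 1 := by
    rw [hb, if_pos rfl, if_neg]; simp only [hjdef]; omega
  have f3 : g.form p (b l) (b l) ≠ 0 := by rw [hb]; simp only [if_true]; split_ifs <;> norm_num
  have z : ∀ {a c}, a ≠ c → g.form p (b a) (b c) = 0 := fun h ↦ by rw [hb, if_neg h]
  exact ⟨_, _, _, .of_orthonormal f1 f2 (z hij) (z hij.symm) (z hil) (z hjl) f3⟩

theorem exists_isNullFrame_inChart (he : e ∈ IsManifold.maximalAtlas 𝓘(ℝ, E) ∞ M) {p : M}
    (hp : p ∈ e.source)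
    (h : ∃ ξ η v : TangentSpace 𝓘(ℝ, E) p, IsNullFrame (g.form p).toLinearMap₁₂ ξ η v) :
    ∃ ξ η v : E, IsNullFrame (g.inChart e (e p)).toLinearMap₁₂ ξ η v := by
  obtain ⟨ξ, η, v, h⟩ := h
  have k := g.inChart_mfderiv he hp
  exact ⟨mfderiv 𝓘(ℝ, E) 𝓘(ℝ, E) e p ξ, mfderiv 𝓘(ℝ, E) 𝓘(ℝ, E) e p η,
    mfderiv 𝓘(ℝ, E) 𝓘(ℝ, E) e p v, (k ξ ξ).trans h.left, (k η η).trans h.right,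
    (k ξ η).trans h.pair, (k ξ v).trans h.orth_left, (k η v).trans h.orth_right,
    fun h' ↦ h.nonnull ((k v v).symm.trans h')⟩

variable [FiniteDimensional ℝ E]

/-- Under the axiom of weakly isotropic planes, the null sectional curvatures vanish. -/
theorem AxiomOfWeaklyIsotropicPlanes.null_curvature_eq_zero (hM : g.AxiomOfWeaklyIsotropicPlanes)
    (he : e ∈ IsManifold.maximalAtlas 𝓘(ℝ, E) ∞ M) {p : M} (hp : p ∈ e.source)
    {x u : TangentSpace 𝓘(ℝ, E) p} (hx : x ≠ 0) (hxx : g.form p x x = 0)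
    (hxu : g.form p x u = 0) (huu : g.form p u u ≠ 0) :
    g.inChart e (e p) (connectionCurvature (leviCivita (g.inChart e)) (e p)
      (mfderiv 𝓘(ℝ, E) 𝓘(ℝ, E) e p x) (mfderiv 𝓘(ℝ, E) 𝓘(ℝ, E) e p u)
      (mfderiv 𝓘(ℝ, E) 𝓘(ℝ, E) e p u)) (mfderiv 𝓘(ℝ, E) 𝓘(ℝ, E) e p x) = 0 := by
  obtain ⟨N, _, _, _, f, hf, -, hgeo, -, q, rfl, hP⟩ :=
    hM p _ (isWeaklyIsotropicPlane_span hx hxx hxu huu)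
  have hw := isWeaklyIsotropicPlane_span hx hxx hxu huu
  replace hP : tangentPlane f q = Submodule.span ℝ {x, u} := hP
  rw [← hP] at hw
  have hxP : x ∈ tangentPlane (E := E) f q := by rw [hP]; exact Submodule.subset_span (by simp)
  have huP : u ∈ tangentPlane (E := E) f q := by rw [hP]; exact Submodule.subset_span (by simp)
  obtain ⟨w, hwP, hR⟩ := hgeo.curvature_mem hf.contMDiff he hp hw.1 hxP huP huP
  rw [hR]
  -- R(x, u)u corresponds to w in span{x, u}, and both x and u are orthogonal to x.
  refine (g.inChart_mfderiv he hp w x).trans ?_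
  rw [hP] at hwP
  obtain ⟨a, b, rfl⟩ := Submodule.mem_span_pair.1 hwP
  have hux : g.form (f q) u x = 0 := by rw [g.symm, hxu]
  simp [hxx, hux]

/-- The derivative of the chart is a surjective isometry, so the null condition holds for all
vectors of E and the algebraic theorem applies. -/
theorem AxiomOfWeaklyIsotropicPlanes.exists_pointwise_const
    (hM : g.AxiomOfWeaklyIsotropicPlanes) (he : e ∈ IsManifold.maximalAtlas 𝓘(ℝ, E) ∞ M) {p : M}
    (hp : p ∈ e.source)
    (h : ∃ ξ η v : TangentSpace 𝓘(ℝ, E) p, IsNullFrame (g.form p).toLinearMap₁₂ ξ η v) :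
    ∃ k : ℝ, HasConstantCurvatureAt (g.inChart e) (e p) k := by
  obtain ⟨ξ, η, v, hF⟩ := exists_isNullFrame_inChart he hp h
  have hmet := g.isMetricOn_inChart he
  have hy := e.map_source hp
  have hem := OpenPartialHomeomorph.MDifferentiable.of_mem_maximalAtlas he
  refine (hmet.isAlgebraicCurvature hy).eq_const_mul_of_null_frame
    (g := (g.inChart e (e p)).toLinearMap₁₂) (hmet.symm _ hy) ?_ hF
  intro x u hx hxx hxu huu
  obtain ⟨x', rfl⟩ := hem.mfderiv_surjective hp x
  obtain ⟨u', rfl⟩ := hem.mfderiv_surjective hp u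
  have k := g.inChart_mfderiv he hp
  refine hM.null_curvature_eq_zero he hp ?_ ((k _ _).symm.trans hxx) ((k _ _).symm.trans hxu)
    (fun h' ↦ huu ((k _ _).trans h'))
  rintro rfl
  exact hx (map_zero (mfderiv 𝓘(ℝ, E) 𝓘(ℝ, E) e p))

end PseudoRiemannianMetric

/-! ### From pointwise to global constancy. -/

theorem IsMetricOn.eventually_eq_of_pointwise_const {E : Type*} [NormedAddCommGroup E]
    [NormedSpace ℝ E] [FiniteDimensional ℝ E] {G : E → E →L[ℝ] E →L[ℝ] ℝ} {U : Set E} {y : E}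
    (h : IsMetricOn G U) (hy : y ∈ U) {k : E → ℝ}
    (hk : ∀ z ∈ U, HasConstantCurvatureAt G z (k z))
    (hF : ∀ z ∈ U, ∃ ξ η v : E, IsNullFrame (G z).toLinearMap₁₂ ξ η v) :
    ∀ᶠ z in nhds y, k z = k y := by
  obtain ⟨r, hr, hball⟩ := Metric.isOpen_iff.1 h.isOpen y hy
  filter_upwards [Metric.ball_mem_nhds y hr] with z hz
  refine Metric.isOpen_ball.is_const_of_fderiv_eq_zero (𝕜 := ℝ)
    (convex_ball y r).isPreconnected (fun w hw ↦ ?_) (fun w hw ↦ ?_) hz (Metric.mem_ball_self hr)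
  · obtain ⟨ξ, η, v, hf⟩ := hF w (hball hw)
    exact (h.differentiableAt_of_pointwise_const (hball hw) hk hf).differentiableWithinAt
  · obtain ⟨ξ, η, v, hf⟩ := hF w (hball hw)
    exact h.fderiv_eq_zero_of_pointwise_const (hball hw) hk hf

namespace PseudoRiemannianMetric

variable {E : Type v} [NormedAddCommGroup E] [NormedSpace ℝ E] [FiniteDimensional ℝ E]
  {M : Type u} [TopologicalSpace M] [ChartedSpace E M] [IsManifold 𝓘(ℝ, E) ∞ M]
  {g : PseudoRiemannianMetric E M} {e e' : OpenPartialHomeomorph M E}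

/-- The value of a pointwise constant curvature does not depend on the chart. -/
theorem const_curvature_eq (he : e ∈ IsManifold.maximalAtlas 𝓘(ℝ, E) ∞ M)
    (he' : e' ∈ IsManifold.maximalAtlas 𝓘(ℝ, E) ∞ M) {p : M} (hp : p ∈ e.source)
    (hp' : p ∈ e'.source)
    (h : ∃ ξ η v : TangentSpace 𝓘(ℝ, E) p, IsNullFrame (g.form p).toLinearMap₁₂ ξ η v)
    {k k' : ℝ} (hk : HasConstantCurvatureAt (g.inChart e) (e p) k)
    (hk' : HasConstantCurvatureAt (g.inChart e') (e' p) k') : k = k' := by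
  obtain ⟨ξ, η, v, hF⟩ := exists_isNullFrame_inChart he hp h
  have hy := e.map_source hp
  have hl := e.left_inv hp
  have hy' : e.symm (e p) ∈ e'.source := by rwa [hl]
  have hG := fun a b ↦ g.inChart_transition he he' hy hy' a b
  have hR := g.fderiv_transition_curvature he he' hy hy' ξ η η
  rw [hl] at hG hR
  -- Both constants are compared on a null frame and its image, where the model takes the nonzero
  -- value -1.
  have h1 := hk ξ η η ξ
  have h2 := hk' (fderiv ℝ (e' ∘ e.symm) (e p) ξ) (fderiv ℝ (e' ∘ e.symm) (e p) η)
    (fderiv ℝ (e' ∘ e.symm) (e p) η) (fderiv ℝ (e' ∘ e.symm) (e p) ξ)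
  rw [← hR, ← hG, ← hG, ← hG, ← hG, ← hG, h1] at h2
  have f1 : g.inChart e (e p) ξ ξ = 0 := hF.left
  have f3 : g.inChart e (e p) ξ η = 1 := hF.pair
  have f4 : g.inChart e (e p) η ξ = 1 := ((g.isMetricOn_inChart he).symm _ hy _ _).trans f3
  rw [f1, f3, f4] at h2
  linarith

theorem sectionalCurvature_eq {p : M} {k : ℝ}
    (hk : HasConstantCurvatureAt (g.inChart (chartAt E p)) (chartAt E p p) k)
    {x y : TangentSpace 𝓘(ℝ, E) p} (h : g.IsNondegeneratePlane p (Submodule.span ℝ {x, y})) :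
    g.sectionalCurvature p x y = k := by
  have hp := mem_chart_source E p
  have he : chartAt E p ∈ IsManifold.maximalAtlas 𝓘(ℝ, E) ∞ M := IsManifold.chart_mem_maximalAtlas p
  have kf := g.inChart_mfderiv he hp
  have hc : g.curvature p x y y x =
      k * (g.form p x x * g.form p y y - g.form p x y ^ 2) := by
    have h1 : g.curvature p x y y x = _ :=
      (congrArg (fun w : E ↦ g.inChart (chartAt E p) (chartAt E p p) w
        (mfderiv 𝓘(ℝ, E) 𝓘(ℝ, E) (chartAt E p) p x : E))
        (g.curvatureInChart_eq he ((chartAt E p).map_source hp) _ _ _)).trans (hk _ _ _ _)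
    refine h1.trans ?_
    refine Eq.trans (congrArg (k * ·) (congrArg₂ (· - ·) (congrArg₂ (· * ·) (kf y y) (kf x x))
      (congrArg₂ (· * ·) (kf x y) (kf y x)))) ?_
    rw [g.symm p y x]
    ring
  rw [sectionalCurvature, hc, mul_div_cancel_right₀ _ h.gram_ne_zero]

end PseudoRiemannianMetric

end

theorem theorem3 {E : Type v} [NormedAddCommGroup E] [NormedSpace ℝ E] [FiniteDimensional ℝ E]
    {M : Type u} [TopologicalSpace M] [ChartedSpace E M] [IsManifold 𝓘(ℝ, E) ∞ M]
    [ConnectedSpace M] (hn : 3 ≤ finrank ℝ E)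
    (g : PseudoRiemannianMetric E M)
    (s : ℕ) (hs : 0 < s) (hsn : s < finrank ℝ E) (hg : g.HasSignature s)
    (hM : g.AxiomOfWeaklyIsotropicPlanes) :
    g.HasConstantSectionalCurvature := by
  have hF := hg.exists_isNullFrame hn hs hsn
  have hchart : ∀ p : M, chartAt E p ∈ IsManifold.maximalAtlas 𝓘(ℝ, E) ∞ M :=
    fun p ↦ IsManifold.chart_mem_maximalAtlas p
  choose K hK using fun p : M ↦ hM.exists_pointwise_const (hchart p) (mem_chart_source E p) (hF p)
  -- K q is computed in the preferred chart at q, which varies with q. Near p it is compared with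
  -- the function k of one fixed chart, to which Schur's theorem applies.
  have hloc : IsLocallyConstant K := by
    rw [IsLocallyConstant.iff_eventually_eq]
    intro p
    set e := chartAt E p
    have he : e ∈ IsManifold.maximalAtlas 𝓘(ℝ, E) ∞ M := hchart p
    have hp : p ∈ e.source := mem_chart_source E p
    have hex : ∀ y : E, ∃ k : ℝ, y ∈ e.target →
        HasConstantCurvatureAt (g.inChart e) y k := by
      intro y
      by_cases hy : y ∈ e.target
      · obtain ⟨k, hk⟩ := hM.exists_pointwise_const he (e.map_target hy) (hF (e.symm y))
        rw [e.right_inv hy] at hk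
        exact ⟨k, fun _ ↦ hk⟩
      · exact ⟨0, fun h ↦ absurd h hy⟩
    choose k hk using hex
    have hframe : ∀ y ∈ e.target, ∃ ξ η v : E,
        IsNullFrame (g.inChart e y).toLinearMap₁₂ ξ η v := by
      intro y hy
      have := PseudoRiemannianMetric.exists_isNullFrame_inChart he (e.map_target hy)
        (hF (e.symm y))
      rwa [e.right_inv hy] at this
    have hev := (g.isMetricOn_inChart he).eventually_eq_of_pointwise_const (e.map_source hp) hk
      hframe
    have hKk : ∀ q ∈ e.source, K q = k (e q) := fun q hq ↦
      PseudoRiemannianMetric.const_curvature_eq (hchart q) he (mem_chart_source E q) hq (hF q)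
        (hK q) (hk _ (e.map_source hq))
    filter_upwards [e.open_source.mem_nhds hp, (e.continuousAt hp).eventually hev] with q hq hq'
    rw [hKk q hq, hKk p hp, hq']
  obtain ⟨p₀⟩ := ‹ConnectedSpace M›.toNonempty
  refine ⟨K p₀, fun p x y hxy ↦ ?_⟩
  rw [PseudoRiemannianMetric.sectionalCurvature_eq (hK p) hxy]
  exact hloc.apply_eq_of_preconnectedSpace p p₀
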